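/- Let $n\ge 2$ be a finite ordinal. Consider algebras $\mathfrak A=\langle A,+,\cdot,-,0,1,c_i,d_{ij}\rangle_{i,j\in n}$ where $+,\cdot$ are binary, $-$ and each $c_i$ are unary, and $0,1,d_{ij}$ are constants. Put $s^i_ix=x$ and, for $i\ne j$, $s^i_jx=c_i(x\cdot d_{ij})$. Let $[i/j]$ be the map $n\to n$ sending $i$ to $j$ and fixing everything else, and $[i,j]$ the map interchanging $i$ and $j$ and fixing everything else. Consider the following axioms. * (Ax0) $\langle A,+,\cdot,-,0,1\rangle$ is a Boolean algebra (possibly with $0=1$). * (Ax1) $c_i0=0$. (Ax2) $x\le c_ix$. (Ax3) $c_i(x\cdot c_iy)=c_ix\cdot c_iy$. (Ax4) $d_{ii}=1$. * (Ax5) $d_{ik}\cdot d_{kj}\le d_{ij}=d_{ji}=c_kd_{ji}$ if $k\ne i,j$. * (Ax6) $c_i(x\cdot d_{ij})\cdot d_{ij}\le x$ if $i\ne j$. * (Ax7) $s^{i_m}_{j_m}c_{k_m}\cdots s^{i_1}_{j_1}c_{k_1}x\cdot\prod_{l\in K}d_{l\tau(l)}\le c_ix$ for all $m\ge1$ and $i_1,\dots,i_m,j_1,\dots,j_m,k_1,\dots,k_m,i\in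 n$ such that $k_{t+1}\notin([i_t/j_t]\circ\cdots\circ[i_1/j_1])[K]$ for $0\le t<m$, where $\tau=[i_m/j_m]\circ\cdots\circ[i_1/j_1]$ and $K=\{i_1,\dots,i_m,k_1,\dots,k_m\}\setminus\{i\}$. * (Ax8) $c_jc_ix\cdot d_{jk}\le c_ic_jx$ if $k\ne i,j$. (Ax9) $d_{ij}=c_k(d_{ik}\cdot d_{kj})$ if $k\ne i,j$. * (Ax10) $s^k_is^i_js^j_ms^m_kc_kx=s^k_ms^m_is^i_js^j_kc_kx$ if $k\ne i,j,m$ and $m\ne i,j$. * (Ax11) $x\cdot -d_{01}\le c_0c_1(-d_{01}\cdot s^0_1c_1x\cdot s^1_0c_0x)$. * (Ax12) $x\le c_ic_j\bigl(s^i_jc_jx\cdot s^j_ic_ix\cdot\prod_{k\ne i,j}s^k_is^i_js^j_kc_kx\bigr)$ for all $i,j\in n$. Let $\mathrm{DC}_n$ be the class of algebras satisfying (Ax0)–(Ax10), and let $\mathrm{SC}_n$ be the class of algebras in $\mathrm{DC}_n$ satisfying (Ax11) if $n=2$ and (Ax12) if $n\ge3$. Let $\mathrm{DC}_n^-$ and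 $\mathrm{SC}_n^-$ be the classes obtained by deleting (Ax7) from the definitions of $\mathrm{DC}_n$ and $\mathrm{SC}_n$, respectively. For a non-empty set $V$ of sequences of length $n$, let $\mathfrak P(V)$ be the algebra of all subsets of $V$ with the Boolean set operations relative to $V$, with $C_iX=\{f\in V:\text{ some }g\in X\text{ agrees with }f\text{ off }i\}$ and $D_{ij}=\{f\in V:f(i)=f(j)\}$. Call $V$ diagonalizable if $f\circ[i/j]\in V$, and permutable if $f\circ[i,j]\in V$, for all $f\in V$ and $i,j\in n$. Let $\mathrm{DCs}_n$ be the class of all subalgebras of algebras $\mathfrak P(V)$ with $V$ non-empty and diagonalizable, and $\mathrm{SCs}_n$ the class of those with $V$ non-empty, diagonalizable and permutable. $\mathbf I$ denotes closure under isomorphic copies. Then: 1. An algebra with $0\neq1$ belongs to $\mathrm{DC}_n^-$ if and only if it belongs to $\mathbf I\,\mathrm{DCs}_n$, and it belongs to $\mathrm{SC}_n^-$ if and only if it belongs to $\mathbf I\,\mathrm{SCs}_n$. All algebras in $\mathbf I\,\mathrm{DCs}_n$ satisfy $0\ne1$. 2. $\mathrm{DC}_n^-=\mathrm{DC}_n$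 and $\mathrm{SC}_n^-=\mathrm{SC}_n$, that is, the infinite scheme (Ax7) can be omitted from the definitions of $\mathrm{DC}_n$ and $\mathrm{SC}_n$. 3. The classes $\mathbf I\,\mathrm{DCs}_n$ and $\mathbf I\,\mathrm{SCs}_n$ are finitely axiomatizable: each is the class of all models of a finite set of first-order sentences. -/

import Mathlib

universe u

namespace CylAlg

open scoped FirstOrder

/-! ### Similarity type -/

/-- The operation symbols `+, ·, -, 0, 1, c_i, d_ij` (`i, j < n`), indexed by arity. -/
inductive Op (n : ℕ) : ℕ → Type
  | add : Op n 2
  | mul : Op n 2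
  | neg : Op n 1
  | zero : Op n 0
  | one : Op n 0
  | cyl (i : Fin n) : Op n 1
  | diag (i j : Fin n) : Op n 0

/-- The (purely functional) first-order language of cylindric-type algebras of dimension `n`. -/
def lang (n : ℕ) : FirstOrder.Language.{0, 0} := ⟨Op n, fun _ => Empty⟩

section Operations

variable (n : ℕ) (A : Type u) [(lang n).Structure A]

/-- The cylindrification `c_i` of an algebra. -/
def cyl (i : Fin n) (x : A) : A :=
  FirstOrder.Language.Structure.funMap (L := lang n) (Op.cyl i : Op n 1) ![x]

/-- The diagonal element `d_ij` of an algebra. -/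
def diag (i j : Fin n) : A :=
  FirstOrder.Language.Structure.funMap (L := lang n) (Op.diag i j : Op n 0) ![]

/-- The Boolean algebra `B` on `A` has the operations `+, ·, -, 0, 1` of the algebra `A`. -/
structure HasReduct (B : BooleanAlgebra A) : Prop where
  add_eq : ∀ x y : A, FirstOrder.Language.Structure.funMap (L := lang n) (Op.add : Op n 2) ![x, y] = x ⊔ y
  mul_eq : ∀ x y : A, FirstOrder.Language.Structure.funMap (L := lang n) (Op.mul : Op n 2) ![x, y] = x ⊓ y
  neg_eq : ∀ x : A, FirstOrder.Language.Structure.funMap (L := lang n) (Op.neg : Op n 1) ![x] = xᶜ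
  zero_eq : FirstOrder.Language.Structure.funMap (L := lang n) (Op.zero : Op n 0) ![] = (⊥ : A)
  one_eq : FirstOrder.Language.Structure.funMap (L := lang n) (Op.one : Op n 0) ![] = (⊤ : A)

end Operations

/-! ### Transformations of the index set -/

/-- The transformation `[i/j]`: it sends `i` to `j` and fixes everything else. -/
def repl {n : ℕ} (i j : Fin n) : Fin n → Fin n := Function.update id i j

/-- `[i_t/j_t] ∘ ⋯ ∘ [i_1/j_1]`, where `i_(t+1) = I t` and `j_(t+1) = J t`. -/
def replChain {n : ℕ} (I J : ℕ → Fin n) : ℕ → Fin n → Fin n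
  | 0 => id
  | t + 1 => repl (I t) (J t) ∘ replChain I J t

/-! ### The axioms, for a Boolean algebra with operations `c_i` and constants `d_ij` -/

section Axioms

variable {n : ℕ} {A : Type u} [BooleanAlgebra A] (c : Fin n → A → A) (d : Fin n → Fin n → A)

/-- `s^i_j x`, which is `x` if `i = j` and `c_i (x · d_ij)` otherwise. -/
def sub (i j : Fin n) (x : A) : A := if i = j then x else c i (x ⊓ d i j)

/-- `s^{i_t}_{j_t} c_{k_t} ⋯ s^{i_1}_{j_1} c_{k_1} x`, where `i_(t+1) = I t`, `j_(t+1) = J t`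
and `k_(t+1) = K t`. -/
def subChain (I J K : ℕ → Fin n) (x : A) : ℕ → A
  | 0 => x
  | t + 1 => sub c d (I t) (J t) (c (K t) (subChain I J K x t))

/-- Axioms (Ax1) to (Ax6). -/
structure BasicAxioms : Prop where
  ax1 : ∀ i, c i ⊥ = ⊥
  ax2 : ∀ i x, x ≤ c i x
  ax3 : ∀ i x y, c i (x ⊓ c i y) = c i x ⊓ c i y
  ax4 : ∀ i, d i i = ⊤
  ax5 : ∀ i j k, k ≠ i → k ≠ j → d i k ⊓ d k j ≤ d i j ∧ d i j = d j i ∧ d j i = c k (d j i)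
  ax6 : ∀ i j, i ≠ j → ∀ x, c i (x ⊓ d i j) ⊓ d i j ≤ x

/-- The axiom scheme (Ax7). -/
def Ax7 : Prop :=
  ∀ (m : ℕ), 1 ≤ m → ∀ (I J K : ℕ → Fin n) (i : Fin n) (S : Finset (Fin n)),
    S = ((Finset.range m).image I ∪ (Finset.range m).image K).erase i →
    (∀ t < m, K t ∉ S.image (replChain I J t)) →
    ∀ x : A, subChain c d I J K x m ⊓ S.inf (fun l => d l (replChain I J m l)) ≤ c i x

/-- Axioms (Ax8) to (Ax10). -/
structure DiagAxioms : Prop where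
  ax8 : ∀ i j k, k ≠ i → k ≠ j → ∀ x, c j (c i x) ⊓ d j k ≤ c i (c j x)
  ax9 : ∀ i j k, k ≠ i → k ≠ j → d i j = c k (d i k ⊓ d k j)
  ax10 : ∀ i j k m, k ≠ i → k ≠ j → k ≠ m → m ≠ i → m ≠ j → ∀ x,
    sub c d k i (sub c d i j (sub c d j m (sub c d m k (c k x)))) =
      sub c d k m (sub c d m i (sub c d i j (sub c d j k (c k x))))

/-- Axiom (Ax11), about the indices `0` and `1`; it is only used in dimension `2`. -/
def Ax11 : Prop :=
  ∀ i j : Fin n, (i : ℕ) = 0 → (j : ℕ) = 1 → ∀ x,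
    x ⊓ (d i j)ᶜ ≤ c i (c j ((d i j)ᶜ ⊓ sub c d i j (c j x) ⊓ sub c d j i (c i x)))

/-- Axiom (Ax12). -/
def Ax12 : Prop :=
  ∀ (i j : Fin n) (x : A),
    x ≤ c i (c j (sub c d i j (c j x) ⊓ sub c d j i (c i x) ⊓
      (Finset.univ.filter fun k => k ≠ i ∧ k ≠ j).inf
        fun k => sub c d k i (sub c d i j (sub c d j k (c k x)))))

/-- (Ax11) in dimension `2`, and (Ax12) in dimensions at least `3`. -/
def PermAxioms : Prop := (n = 2 → Ax11 c d) ∧ (3 ≤ n → Ax12 c d)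

end Axioms

/-! ### The axiomatic classes -/

section Classes

variable (n : ℕ) (A : Type u) [(lang n).Structure A]

/-- `A ∈ DC_n⁻`: axioms (Ax0) to (Ax6) and (Ax8) to (Ax10). -/
def IsDCMinus : Prop :=
  ∃ B : BooleanAlgebra A, HasReduct n A B ∧
    BasicAxioms (cyl n A) (diag n A) ∧ DiagAxioms (cyl n A) (diag n A)

/-- `A ∈ DC_n`: axioms (Ax0) to (Ax10). -/
def IsDC : Prop :=
  ∃ B : BooleanAlgebra A, HasReduct n A B ∧
    BasicAxioms (cyl n A) (diag n A) ∧ Ax7 (cyl n A) (diag n A) ∧ DiagAxioms (cyl n A) (diag n A)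

/-- `A ∈ SC_n⁻`: the axioms of `DC_n⁻` and (Ax11) if `n = 2`, (Ax12) if `n ≥ 3`. -/
def IsSCMinus : Prop :=
  ∃ B : BooleanAlgebra A, HasReduct n A B ∧
    BasicAxioms (cyl n A) (diag n A) ∧ DiagAxioms (cyl n A) (diag n A) ∧
    PermAxioms (cyl n A) (diag n A)

/-- `A ∈ SC_n`: the axioms of `DC_n` and (Ax11) if `n = 2`, (Ax12) if `n ≥ 3`. -/
def IsSC : Prop :=
  ∃ B : BooleanAlgebra A, HasReduct n A B ∧
    BasicAxioms (cyl n A) (diag n A) ∧ Ax7 (cyl n A) (diag n A) ∧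
    DiagAxioms (cyl n A) (diag n A) ∧ PermAxioms (cyl n A) (diag n A)

end Classes

/-! ### Set algebras -/

/-- The universe of the full algebra `P(V)`: all subsets of `V`. -/
def FullAlg {n : ℕ} {U : Type u} (V : Set (Fin n → U)) : Type u := Set V

/-- The operations of the full algebra `P(V)`: the Boolean set operations relative to `V`,
`C_i X = {f ∈ V : f ≡_i g for some g ∈ X}` and `D_ij = {f ∈ V : f i = f j}`. -/
instance FullAlg.instStructure {n : ℕ} {U : Type u} (V : Set (Fin n → U)) :
    (lang n).Structure (FullAlg V) where
  funMap := fun {_} o => match o with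
    | Op.add => fun x => (x 0 ∪ x 1 : Set V)
    | Op.mul => fun x => (x 0 ∩ x 1 : Set V)
    | Op.neg => fun x => ((x 0)ᶜ : Set V)
    | Op.zero => fun _ => (∅ : Set V)
    | Op.one => fun _ => (Set.univ : Set V)
    | Op.cyl i => fun (x : Fin 1 → Set V) =>
        {f : V | ∃ g : V, g ∈ x 0 ∧ ∀ j : Fin n, j ≠ i → g.1 j = f.1 j}
    | Op.diag i j => fun _ => {f : V | f.1 i = f.1 j}
  RelMap := fun {_} r => nomatch r

/-- `V` is diagonalizable: closed under `f ↦ f ∘ [i/j]`. -/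
def Diagonalizable {n : ℕ} {U : Type u} (V : Set (Fin n → U)) : Prop :=
  ∀ f ∈ V, ∀ i j : Fin n, f ∘ repl i j ∈ V

/-- `V` is permutable: closed under `f ↦ f ∘ [i,j]`. -/
def Permutable {n : ℕ} {U : Type u} (V : Set (Fin n → U)) : Prop :=
  ∀ f ∈ V, ∀ i j : Fin n, f ∘ Equiv.swap i j ∈ V

/-- `A ∈ I DCs_n`: `A` is isomorphic to a subalgebra of some `P(V)` with `V` non-empty and
diagonalizable. -/
def IsRepDC (n : ℕ) (A : Type u) [(lang n).Structure A] : Prop :=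
  ∃ (U : Type u) (V : Set (Fin n → U)), V.Nonempty ∧ Diagonalizable V ∧
    ∃ B : (lang n).Substructure (FullAlg V), Nonempty (A ≃[lang n] B)

/-- `A ∈ I SCs_n`: `A` is isomorphic to a subalgebra of some `P(V)` with `V` non-empty,
diagonalizable and permutable. -/
def IsRepSC (n : ℕ) (A : Type u) [(lang n).Structure A] : Prop :=
  ∃ (U : Type u) (V : Set (Fin n → U)), V.Nonempty ∧ Diagonalizable V ∧ Permutable V ∧
    ∃ B : (lang n).Substructure (FullAlg V), Nonempty (A ≃[lang n] B)

/-- A class of algebras is finitely axiomatizable: it consists of all the models of some finite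
set of first-order sentences. -/
def FinitelyAxiomatizable (n : ℕ) (C : ∀ (A : Type u) [(lang n).Structure A], Prop) : Prop :=
  ∃ T : (lang n).Theory, T.Finite ∧ ∀ (A : Type u) [(lang n).Structure A], A ⊨ T ↔ C A

end CylAlg

namespace CylAlg

/-! The hard direction represents an algebra `A` that satisfies the axioms without (Ax7). Its
ultrafilters form a `Frame`: `rel i` is dual to `c_i`, `E i j` to `d_ij`, and the function `e i j`
to `s^i_j`, which is a Boolean endomorphism. If a set `V` of sequences carries a surjection `lab`
onto the frame that respects `rel` and `E` and has the back property (`Frame.Representation`), then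
`x ↦ {f | x ∈ lab f}` embeds `A` into `P(V)`. Diagonalizability of `V` comes for free from the back
property along `e i j`.

The combinatorial core is `Frame.act_congr`: a word in the replacements `[i/j]` acts on a point in a
way that depends only on the transformation it composes to. Keep a transversal `T` of the kernel of
that transformation and treat the other places as holes whose content is ignored. On points with
holes, a transposition can be performed with one hole as temporary storage. (Ax10) yields the
relations between these transpositions, which present the symmetric group, so permutations act. A
word that is injective on `T` acts like a permutation, and two words with the same transformation
differ by a permutation that fixes `T` and hence acts trivially. The holes of the result are then
recovered, since each repeats a kept place.

The representation is an unravelling. A path permutes the places and changes one place at each step;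
a changed place either repeats the value of another place, as the diagonals of the new point
dictate, or receives a brand-new value that names the path creating it. `PermChoice.act_label_eq`
shows that equal values force equal labels after words: a word not using the newest value can be
pushed back one step, until `act_congr` applies. Only the identity is allowed as a permutation for
DC. For SC all permutations are allowed, the permuted points being supplied by (Ax11) or (Ax12).

Conversely, set algebras satisfy the axioms, including (Ax7), by direct computation with sequences,
and equations pass to subalgebras. So (Ax7) follows in `A` from representability, the one-element
algebra being trivial. Finite axiomatizability holds because, apart from (Ax7), the axioms are
finitely many equations, to which `0 ≠ 1` is added. -/

/-! ### A presentation of finite symmetric groups by transpositions -/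

/-- A family of elements of a group that satisfies the defining relations of transpositions. -/
structure SwapFamily {α : Type*} {G : Type*} [Group G] (T : α → α → G) : Prop where
  symm : ∀ i j, i ≠ j → T i j = T j i
  sq : ∀ i j, i ≠ j → T i j * T i j = 1
  conj : ∀ i j m, i ≠ j → j ≠ m → m ≠ i → T i j * T j m = T m i * T i j

namespace SwapFamily

variable {α : Type*} {G : Type*} [Group G] {T : α → α → G}

theorem conj' (h : SwapFamily T) {i j m : α} (hij : i ≠ j) (hjm : j ≠ m) (hmi : m ≠ i) :
    T i j * T j m * T i j = T m i := by
  rw [h.conj i j m hij hjm hmi, mul_assoc, h.sq i j hij, mul_one]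

/-- Commutation of disjoint transpositions need not be postulated: `T l i` is a conjugate of `T j l`
by `T i j` and of `T k l` by `T i k`. Expanding both over `i j`, `j k`, `k l` and cancelling leaves
the claim. -/
theorem comm (h : SwapFamily T) {i j k l : α} (hij : i ≠ j) (hik : i ≠ k) (hil : i ≠ l)
    (hjk : j ≠ k) (hjl : j ≠ l) (hkl : k ≠ l) : T i j * T k l = T k l * T i j := by
  have h1 : T j k * T k l * T j k = T j l := by
    rw [h.conj' hjk hkl hjl.symm, h.symm l j hjl.symm]
  have h2 : T i j * T j l * T i j = T i k * T k l * T i k := by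
    rw [h.conj' hij hjl hil.symm, h.conj' hik hkl hil.symm]
  have h3 : T i j * T j k * T i j = T i k := by
    rw [h.conj' hij hjk hik.symm, h.symm k i hik.symm]
  rw [← h1, ← h3] at h2
  have h4 : T k l = T i j * T k l * T i j := by
    simp only [mul_assoc] at h2
    have h5 := mul_left_cancel (mul_left_cancel h2)
    simp only [← mul_assoc] at h5
    exact mul_right_cancel (mul_right_cancel h5)
  conv_rhs => rw [h4]
  rw [mul_assoc, h.sq i j hij, mul_one]

/-- The subgroup generated by the transpositions of elements of `S`. -/
def span (T : α → α → G) (S : Set α) : Subgroup G :=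
  Subgroup.closure {x | ∃ i ∈ S, ∃ j ∈ S, i ≠ j ∧ x = T i j}

theorem mem_span {S : Set α} {i j : α} (hi : i ∈ S) (hj : j ∈ S) (hij : i ≠ j) :
    T i j ∈ span T S :=
  Subgroup.subset_closure ⟨i, hi, j, hj, hij, rfl⟩

theorem mul_mem_span_insert (h : SwapFamily T) {S : Set α} {s i j : α} (hs : s ∉ S)
    (hi : i ∈ insert s S) (hj : j ∈ insert s S) (hij : i ≠ j) {x : G}
    (hx : x ∈ span T S ∨ ∃ y ∈ span T S, ∃ z ∈ S, x = y * T s z) :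
    x * T i j ∈ span T S ∨ ∃ y ∈ span T S, ∃ z ∈ S, x * T i j = y * T s z := by
  have key : ∀ k ∈ S, x * T s k ∈ span T S ∨ ∃ y ∈ span T S, ∃ z ∈ S, x * T s k = y * T s z := by
    intro k hk
    have hsk : s ≠ k := fun e => hs (e ▸ hk)
    rcases hx with hx | ⟨y, hy, z, hz, rfl⟩
    · exact Or.inr ⟨x, hx, k, hk, rfl⟩
    · have hsz : s ≠ z := fun e => hs (e ▸ hz)
      by_cases hzk : z = k
      · subst hzk
        left
        rwa [mul_assoc, h.sq s z hsz, mul_one]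
      · right
        refine ⟨y * T k z, mul_mem hy (mem_span hk hz (Ne.symm hzk)), z, hz, ?_⟩
        rw [mul_assoc, mul_assoc, h.symm s z hsz, h.conj z s k hsz.symm hsk (Ne.symm hzk)]
  rcases hi with rfl | hi <;> rcases hj with rfl | hj
  · exact absurd rfl hij
  · exact key j hj
  · rw [h.symm i j hij]
    exact key i hi
  · have hsi : s ≠ i := fun e => hs (e ▸ hi)
    have hsj : s ≠ j := fun e => hs (e ▸ hj)
    rcases hx with hx | ⟨y, hy, z, hz, rfl⟩
    · exact Or.inl (mul_mem hx (mem_span hi hj hij))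
    · have hsz : s ≠ z := fun e => hs (e ▸ hz)
      right
      have hy' := mul_mem hy (mem_span (T := T) hi hj hij)
      by_cases hzi : z = i
      · subst hzi
        refine ⟨_, hy', j, hj, ?_⟩
        rw [mul_assoc, mul_assoc, ← h.conj z j s hij hsj.symm hsz, h.symm j s hsj.symm]
      by_cases hzj : z = j
      · subst hzj
        refine ⟨_, hy', i, hi, ?_⟩
        rw [mul_assoc, mul_assoc, h.symm i z hij, ← h.conj z i s (Ne.symm hij) hsi.symm hsz,
          h.symm i s hsi.symm]
      · refine ⟨_, hy', z, hz, ?_⟩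
        rw [mul_assoc, mul_assoc, h.comm hsz hsi hsj hzi hzj hij]

/-- A normal form by cosets, mirroring the cosets of a point stabilizer in the symmetric group. -/
theorem mem_span_insert (h : SwapFamily T) {S : Set α} {s : α} (hs : s ∉ S) {x : G}
    (hx : x ∈ span T (insert s S)) :
    x ∈ span T S ∨ ∃ y ∈ span T S, ∃ z ∈ S, x = y * T s z := by
  induction hx using Subgroup.closure_induction_right with
  | one => exact Or.inl (one_mem _)
  | mul_right x y _ hy ih =>
    obtain ⟨i, hi, j, hj, hij, rfl⟩ := hy
    exact h.mul_mem_span_insert hs hi hj hij ih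
  | mul_inv_cancel x y _ hy ih =>
    obtain ⟨i, hi, j, hj, hij, rfl⟩ := hy
    rw [inv_eq_of_mul_eq_one_right (h.sq i j hij)]
    exact h.mul_mem_span_insert hs hi hj hij ih

theorem swap [DecidableEq α] : SwapFamily (fun i j : α => Equiv.swap i j) where
  symm i j _ := Equiv.swap_comm i j
  sq i j _ := Equiv.swap_mul_self i j
  conj i j m hij hjm hmi := by
    ext x
    simp only [Equiv.Perm.mul_apply, Equiv.swap_apply_def]
    grind

theorem prod {H : Type*} [Group H] {T' : α → α → H} (h : SwapFamily T) (h' : SwapFamily T') :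
    SwapFamily (fun i j => (T i j, T' i j)) where
  symm i j hij := by simp only [h.symm i j hij, h'.symm i j hij]
  sq i j hij := by simp only [Prod.mk_mul_mk, h.sq i j hij, h'.sq i j hij, Prod.mk_one_one]
  conj i j m hij hjm hmi := by
    simp only [Prod.mk_mul_mk, h.conj i j m hij hjm hmi, h'.conj i j m hij hjm hmi]

theorem fst_fixes [DecidableEq α] {S : Set α} {s : α} (hs : s ∉ S) {x : Equiv.Perm α × G}
    (hx : x ∈ span (fun i j => (Equiv.swap i j, T i j)) S) : x.1 s = s := by
  induction hx using Subgroup.closure_induction with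
  | mem x hx =>
    obtain ⟨i, hi, j, hj, hij, rfl⟩ := hx
    exact Equiv.swap_apply_of_ne_of_ne (fun e => hs (e ▸ hi)) (fun e => hs (e ▸ hj))
  | one => rfl
  | mul x y _ _ hx hy => simp [hx, hy]
  | inv x _ hx => exact Equiv.Perm.inv_eq_iff_eq.2 hx.symm

/-- This makes the subgroup generated by the pairs `(swap i j, T i j)` the graph of a function. In
the normal form `y * T s z` the permutation sends `z` to `s`, because `y` fixes `s`; so it is not
the identity, and only the coset of `span T S` remains. -/
theorem eq_one_of_fst_eq_one [DecidableEq α] (h : SwapFamily T) (S : Finset α) :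
    ∀ x ∈ span (fun i j => (Equiv.swap i j, T i j)) (S : Set α), x.1 = 1 → x = 1 := by
  induction S using Finset.induction_on with
  | empty =>
    intro x hx _
    have : span (fun i j => (Equiv.swap i j, T i j)) ((∅ : Finset α) : Set α) = ⊥ := by
      simp [span]
    rwa [this, Subgroup.mem_bot] at hx
  | insert s S hs ih =>
    intro x hx h1
    rw [Finset.coe_insert] at hx
    rcases (swap.prod h).mem_span_insert (by simpa using hs) hx with hx | ⟨y, hy, z, hz, rfl⟩
    · exact ih x hx h1
    · exfalso
      have h2 : (y.1 * Equiv.swap s z) z = z := by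
        have : (y * (Equiv.swap s z, T s z)).1 = y.1 * Equiv.swap s z := rfl
        rw [← this, h1, Equiv.Perm.one_apply]
      rw [Equiv.Perm.mul_apply, Equiv.swap_apply_right, fst_fixes (by simpa using hs) hy] at h2
      exact hs (h2 ▸ hz)

/-- The transpositions with their relations present the symmetric group. -/
theorem exists_hom [Fintype α] [DecidableEq α] (h : SwapFamily T) :
    ∃ Φ : Equiv.Perm α →* G, ∀ i j, i ≠ j → Φ (Equiv.swap i j) = T i j := by
  let K := span (fun i j => (Equiv.swap i j, T i j)) ((Finset.univ : Finset α) : Set α)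
  have hex : ∀ π : Equiv.Perm α, ∃ g, (π, g) ∈ K := by
    intro π
    induction π using Equiv.Perm.swap_induction_on with
    | one => exact ⟨1, one_mem K⟩
    | swap_mul π x y hxy ih =>
      obtain ⟨g, hg⟩ := ih
      exact ⟨T x y * g, mul_mem (mem_span (T := fun i j => (Equiv.swap i j, T i j))
        (Finset.mem_coe.2 (Finset.mem_univ x)) (Finset.mem_coe.2 (Finset.mem_univ y)) hxy) hg⟩
  have huniq : ∀ (π : Equiv.Perm α) (g g' : G), (π, g) ∈ K → (π, g') ∈ K → g = g' := by
    intro π g g' hg hg'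
    have := h.eq_one_of_fst_eq_one Finset.univ _ (mul_mem hg (inv_mem hg')) (by simp)
    exact mul_inv_eq_one.1 (congrArg Prod.snd this)
  choose φ hφ using hex
  refine ⟨MonoidHom.mk' φ fun π ρ => huniq (π * ρ) _ _ (hφ _) (mul_mem (hφ π) (hφ ρ)), ?_⟩
  intro i j hij
  exact huniq _ _ _ (hφ _) (mem_span (T := fun i j => (Equiv.swap i j, T i j))
    (Finset.mem_coe.2 (Finset.mem_univ i)) (Finset.mem_coe.2 (Finset.mem_univ j)) hij)

end SwapFamily

/-! ### Frames -/

/-- The atom structures of algebras in `DC_n⁻`, with the substitution `e i j` of `[i/j]` named. -/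
structure Frame (n : ℕ) (W : Type u) where
  rel : Fin n → W → W → Prop
  E : Fin n → Fin n → W → Prop
  e : Fin n → Fin n → W → W
  rel_equiv : ∀ i, Equivalence (rel i)
  E_refl : ∀ i a, E i i a
  E_symm : ∀ {i j a}, E i j a → E j i a
  E_trans : ∀ {i j k a}, E i j a → E j k a → E i k a
  E_rel : ∀ {i j k a b}, k ≠ i → k ≠ j → rel k a b → E i j a → E i j b
  E_uniq : ∀ {i j a b}, i ≠ j → rel i a b → E i j a → E i j b → a = b
  e_self : ∀ i a, e i i a = a
  e_rel : ∀ i j a, rel i a (e i j a)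
  e_E : ∀ i j a, E i j (e i j a)
  rel_comm : ∀ {i j k a b c}, k ≠ i → k ≠ j → E j k a → rel j a b → rel i b c →
    ∃ b', rel i a b' ∧ rel j b' c
  -- This is (Ax10) read on points, where the substitutions act in the opposite order and `c_k`
  -- becomes the comparison modulo `rel k`.
  mgr : ∀ {i j k m}, k ≠ i → k ≠ j → k ≠ m → m ≠ i → m ≠ j → ∀ a,
    rel k (e m k (e j m (e i j (e k i a)))) (e j k (e i j (e m i (e k m a))))

namespace Frame

variable {n : ℕ} {W : Type u} (F : Frame n W) {i j k l m g h : Fin n} {a b : W}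

theorem rel_refl (i : Fin n) (a : W) : F.rel i a a := (F.rel_equiv i).refl a

variable {F}

theorem rel_symm (h : F.rel i a b) : F.rel i b a := (F.rel_equiv i).symm h

theorem rel_trans {c : W} (h : F.rel i a b) (h' : F.rel i b c) : F.rel i a c :=
  (F.rel_equiv i).trans h h'

variable (F)

theorem e_rel' (i j : Fin n) (a : W) : F.rel i (F.e i j a) a := rel_symm (F.e_rel i j a)

theorem eq_e (hij : i ≠ j) (h : F.rel i a b) (hb : F.E i j b) : F.e i j a = b :=
  F.E_uniq hij (rel_trans (F.e_rel' i j a) h) (F.e_E i j a) hb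

theorem e_congr (hij : i ≠ j) (h : F.rel i a b) : F.e i j a = F.e i j b :=
  F.eq_e hij (rel_trans h (F.e_rel i j b)) (F.e_E i j b)

theorem rel_of_e_eq (h : F.e i j a = F.e i j b) : F.rel i a b :=
  rel_trans (F.e_rel i j a) (h ▸ F.e_rel' i j b)

theorem e_eq_self (h : F.E i j a) : F.e i j a = a := by
  by_cases hij : i = j
  · subst hij; exact F.e_self i a
  · exact F.eq_e hij (F.rel_refl i a) h

theorem e_e_rev : F.e j i (F.e i j a) = F.e i j a := F.e_eq_self (F.E_symm (F.e_E i j a))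

theorem e_e_same (hik : i ≠ k) : F.e i k (F.e i j a) = F.e i k a :=
  F.e_congr hik (F.e_rel' i j a)

theorem E_iff_of_rel (hi : k ≠ i) (hj : k ≠ j) (h : F.rel k a b) : F.E i j a ↔ F.E i j b :=
  ⟨F.E_rel hi hj h, F.E_rel hi hj (rel_symm h)⟩

/-- The point `b'` supplied by `rel_comm` has both required diagonals, and uniqueness in each
direction identifies it with either side. -/
theorem e_comm (hik : i ≠ k) (hil : i ≠ l) (hkj : k ≠ j) :
    F.e k l (F.e i j a) = F.e i j (F.e k l a) := by
  by_cases hij : i = j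
  · subst hij; simp only [F.e_self]
  by_cases hkl : k = l
  · subst hkl; simp only [F.e_self]
  obtain ⟨b', h1, h2⟩ := F.rel_comm (i := i) (j := k) (k := l) hil.symm (Ne.symm hkl)
    (F.e_E k l a) (F.e_rel' k l a) (F.e_rel i j a)
  have h3 : F.E k l b' := F.E_rel hik hil h1 (F.e_E k l a)
  have h4 : F.e k l (F.e i j a) = b' := F.eq_e hkl (rel_symm h2) h3
  rw [h4]
  refine (F.eq_e hij h1 ?_).symm
  rw [← h4]
  exact F.E_rel hik.symm hkj (F.e_rel k l _) (F.e_E i j a)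

theorem e_eq_of_E (hij : i ≠ j) (hik : i ≠ k) (h : F.E j k a) : F.e i j a = F.e i k a := by
  refine (F.eq_e hik (F.e_rel i j a) ?_).symm
  exact F.E_trans (F.e_E i j a) (F.E_rel hij hik (F.e_rel i j a) h)

theorem rel_e (hgi : g ≠ i) (hgj : g ≠ j) (h : F.rel g a b) : F.rel g (F.e i j a) (F.e i j b) := by
  apply F.rel_of_e_eq (j := j)
  by_cases hij : i = j
  · subst hij; simp only [F.e_self]; exact F.e_congr hgj h
  rw [F.e_comm hgi.symm hij hgj, F.e_comm hgi.symm hij hgj, F.e_congr hgj h]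

theorem E_e_iff (i j l m : Fin n) : F.E l m (F.e i j a) ↔ F.E (repl i j l) (repl i j m) a := by
  by_cases hij : i = j
  · subst hij
    have : repl i i = id := by simp [repl]
    rw [this, F.e_self]; rfl
  have key : ∀ m, m ≠ i → (F.E i m (F.e i j a) ↔ F.E j m a) := by
    intro m hm
    rw [F.E_iff_of_rel hij (Ne.symm hm) (F.e_rel i j a)]
    exact ⟨fun h => F.E_trans (F.E_symm (F.e_E i j a)) h, fun h => F.E_trans (F.e_E i j a) h⟩
  by_cases hl : l = i <;> by_cases hm : m = i
  · subst hl; subst hm; exact ⟨fun _ => F.E_refl _ _, fun _ => F.E_refl _ _⟩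
  · subst hl; simpa [repl, hm] using key m hm
  · subst hm
    simp only [repl, Function.update_self, Function.update_of_ne hl, id]
    exact ⟨fun h => F.E_symm ((key l hl).1 (F.E_symm h)),
      fun h => F.E_symm ((key l hl).2 (F.E_symm h))⟩
  · simp only [repl, Function.update_of_ne hl, Function.update_of_ne hm, id]
    exact (F.E_iff_of_rel (Ne.symm hl) (Ne.symm hm) (F.e_rel i j a)).symm

/-- The action of the transposition of `i` and `j`, with `h` as the place that is disregarded. -/
def tr (h i j : Fin n) (a : W) : W := F.e j h (F.e i j (F.e h i a))

/-- The degenerate instance of `mgr` in which the first two indices coincide. -/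
theorem tr_rel_tr_symm (hhi : h ≠ i) (hhj : h ≠ j) (hij : i ≠ j) :
    F.rel h (F.tr h i j a) (F.tr h j i a) := by
  have := F.mgr (i := i) (j := i) (k := h) (m := j) hhi hhi hhj hij.symm hij.symm a
  simpa only [F.e_self, tr] using this

theorem tr_congr (hhi : h ≠ i) (hr : F.rel h a b) : F.tr h i j a = F.tr h i j b := by
  rw [tr, tr, F.e_congr hhi hr]

/-- With two places to ignore, either may store the value of `i`. The common comparison point stores
it in both, after which reading it back from `g` or from `h` gives the same result. -/
theorem tr_rel_tr_of_ne (hgh : g ≠ h) (hhi : h ≠ i) (hhj : h ≠ j) (hgi : g ≠ i) (hgj : g ≠ j) :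
    F.rel g (F.tr h i j a) (F.e j h (F.e i j (F.e h i (F.e g i a)))) ∧
    F.rel h (F.tr g i j a) (F.e j h (F.e i j (F.e h i (F.e g i a)))) := by
  constructor
  · exact F.rel_e hgj hgh (F.rel_e hgi hgj (F.rel_e hgh hgi (F.e_rel g i a)))
  · have h1 : F.rel h (F.tr g i j a) (F.tr g i j (F.e h i a)) :=
      F.rel_e hhj hgh.symm (F.rel_e hhi hhj (F.rel_e hgh.symm hhi (F.e_rel h i a)))
    have h2 : F.E g h (F.e i j (F.e h i (F.e g i a))) := by
      refine F.E_rel hgi.symm hhi.symm (F.e_rel i j _) ?_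
      refine F.E_trans (j := i) ?_ (F.E_symm (F.e_E h i _))
      exact F.E_rel hgh.symm hhi (F.e_rel h i _) (F.e_E g i a)
    rw [← F.e_eq_of_E hgj.symm hhj.symm h2, F.e_comm hgh hgi hhi]
    exact h1

theorem tr_tr (hhj : h ≠ j) (hij : i ≠ j) :
    F.rel h (F.tr h i j (F.tr h j i a)) a := by
  simp only [tr]
  rw [F.e_e_rev (i := i) (j := h), F.e_e_same hij, F.e_e_rev, F.e_e_same hhj.symm, F.e_e_rev]
  exact F.e_rel' _ _ _

/-- After cancelling a value stored in `h` and immediately restored, both sides are the cyclic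
rotation of three places, started at different places; this is `mgr`. -/
theorem tr_tr_rel (hhi : h ≠ i) (hhj : h ≠ j) (hhm : h ≠ m) (hij : i ≠ j) (hjm : j ≠ m)
    (hmi : m ≠ i) : F.rel h (F.tr h j m (F.tr h i j a)) (F.tr h i j (F.tr h m i a)) := by
  simp only [tr]
  rw [F.e_e_rev (i := j) (j := h), F.e_e_rev (i := i) (j := h), F.e_e_same hjm, F.e_e_same hij]
  exact F.mgr hhi hhj hhm hmi hjm.symm a

end Frame

namespace Frame

variable {n : ℕ} {W : Type u} (F : Frame n W)

/-! ### Points with a set of disregarded places, and the action of permutations on them -/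

/-- Points are identified when they differ only at disregarded places. -/
inductive HoleRel : Finset (Fin n) × W → Finset (Fin n) × W → Prop
  | mk (H : Finset (Fin n)) (h : Fin n) (a b : W) : h ∈ H → F.rel h a b → HoleRel (H, a) (H, b)

/-- Points with a set of disregarded places. -/
def Punctured : Type u := Quot F.HoleRel

/-- The class of the point `a` with disregarded places `H`. -/
def punct (H : Finset (Fin n)) (a : W) : F.Punctured := Quot.mk _ (H, a)

variable {i j k l m g h : Fin n} {a b : W} {H H' : Finset (Fin n)}

theorem punct_eq (hH : H = H') (h : Fin n) (hh : h ∈ H) (hr : F.rel h a b) :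
    F.punct H a = F.punct H' b := by
  subst hH; exact Quot.sound (HoleRel.mk H h a b hh hr)

theorem punct_eq_e (hH : H = H') (h j : Fin n) (hh : h ∈ H) :
    F.punct H a = F.punct H' (F.e h j a) := F.punct_eq hH h hh (F.e_rel h j a)

theorem punct_tr_eq (hh : h ∈ H) (hg : g ∈ H) (hi : i ∉ H) (hj : j ∉ H) :
    F.punct H (F.tr h i j a) = F.punct H (F.tr g i j a) := by
  by_cases hgh : g = h
  · rw [hgh]
  have := F.tr_rel_tr_of_ne (g := g) (h := h) (i := i) (j := j) (a := a) hgh (by grind) (by grind)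
    (by grind) (by grind)
  exact (F.punct_eq rfl g hg this.1).trans (F.punct_eq rfl h hh this.2).symm

open Classical in
/-- The action of the transposition of `i` and `j` on representatives. -/
noncomputable def preTrans (i j : Fin n) (x : Finset (Fin n) × W) : F.Punctured :=
  if i ∈ x.1 then
    if j ∈ x.1 then F.punct x.1 x.2 else F.punct (insert j (x.1.erase i)) (F.e i j x.2)
  else if j ∈ x.1 then F.punct (insert i (x.1.erase j)) (F.e j i x.2)
  -- Any hole can serve as the storage, by `punct_tr_eq`. Without holes the action is trivial by
  -- convention, which keeps all relations true.
  else if hx : x.1.Nonempty then F.punct x.1 (F.tr hx.choose i j x.2) else F.punct x.1 x.2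

theorem preTrans_of_notMem (hi : i ∉ H) (hj : j ∉ H) (hh : h ∈ H) :
    F.preTrans i j (H, a) = F.punct H (F.tr h i j a) := by
  have hx : H.Nonempty := ⟨h, hh⟩
  simp only [preTrans, hi, hj, hx, if_false, dif_pos]
  exact F.punct_tr_eq hx.choose_spec hh hi hj

theorem punct_e_congr (hi : i ∈ H) (hj : j ∉ H) (hh : h ∈ H) (hr : F.rel h a b) :
    F.punct (insert j (H.erase i)) (F.e i j a) = F.punct (insert j (H.erase i)) (F.e i j b) := by
  by_cases hhi : h = i
  · subst hhi
    rw [F.e_congr (by grind) hr]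
  · exact F.punct_eq rfl h (by grind) (F.rel_e hhi (by grind) hr)

theorem preTrans_congr {x y : Finset (Fin n) × W} (hxy : F.HoleRel x y) :
    F.preTrans i j x = F.preTrans i j y := by
  obtain ⟨H, h, a, b, hh, hr⟩ := hxy
  by_cases hi : i ∈ H <;> by_cases hj : j ∈ H
  · simpa only [preTrans, hi, hj, if_true] using F.punct_eq rfl h hh hr
  · simpa only [preTrans, hi, hj, if_true, if_false] using F.punct_e_congr hi hj hh hr
  · simpa only [preTrans, hi, hj, if_true, if_false] using F.punct_e_congr hj hi hh hr
  · rw [F.preTrans_of_notMem hi hj hh, F.preTrans_of_notMem hi hj hh, F.tr_congr (by grind) hr]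

/-- The action of the transposition of `i` and `j`. -/
noncomputable def trans (i j : Fin n) : F.Punctured → F.Punctured :=
  Quot.lift (F.preTrans i j) fun _ _ => F.preTrans_congr

theorem trans_mem_mem (hi : i ∈ H) (hj : j ∈ H) : F.trans i j (F.punct H a) = F.punct H a := by
  change F.preTrans i j (H, a) = _
  simp [preTrans, hi, hj]

theorem trans_mem_notMem (hi : i ∈ H) (hj : j ∉ H) :
    F.trans i j (F.punct H a) = F.punct (insert j (H.erase i)) (F.e i j a) := by
  change F.preTrans i j (H, a) = _
  simp [preTrans, hi, hj]

theorem trans_notMem_mem (hi : i ∉ H) (hj : j ∈ H) :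
    F.trans i j (F.punct H a) = F.punct (insert i (H.erase j)) (F.e j i a) := by
  change F.preTrans i j (H, a) = _
  simp [preTrans, hi, hj]

theorem trans_notMem_notMem (hi : i ∉ H) (hj : j ∉ H) (hh : h ∈ H) :
    F.trans i j (F.punct H a) = F.punct H (F.tr h i j a) :=
  F.preTrans_of_notMem hi hj hh

theorem trans_empty : F.trans i j (F.punct ∅ a) = F.punct ∅ a := by
  change F.preTrans i j (∅, a) = _
  simp [preTrans]

theorem trans_symm (hij : i ≠ j) (x : F.Punctured) : F.trans i j x = F.trans j i x := by
  induction x using Quot.ind with | mk x =>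
  obtain ⟨H, a⟩ := x
  change F.trans i j (F.punct H a) = F.trans j i (F.punct H a)
  by_cases hi : i ∈ H <;> by_cases hj : j ∈ H
  · rw [F.trans_mem_mem hi hj, F.trans_mem_mem hj hi]
  · rw [F.trans_mem_notMem hi hj, F.trans_notMem_mem hj hi]
  · rw [F.trans_notMem_mem hi hj, F.trans_mem_notMem hj hi]
  · rcases H.eq_empty_or_nonempty with rfl | ⟨h, hh⟩
    · simp only [F.trans_empty]
    · rw [F.trans_notMem_notMem hi hj hh, F.trans_notMem_notMem hj hi hh]
      exact F.punct_eq rfl h hh (F.tr_rel_tr_symm (by grind) (by grind) hij)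

theorem trans_trans (hij : i ≠ j) (x : F.Punctured) : F.trans i j (F.trans i j x) = x := by
  induction x using Quot.ind with | mk x =>
  obtain ⟨H, a⟩ := x
  change F.trans i j (F.trans i j (F.punct H a)) = F.punct H a
  by_cases hi : i ∈ H <;> by_cases hj : j ∈ H
  · simp only [F.trans_mem_mem hi hj]
  · rw [F.trans_mem_notMem hi hj, F.trans_notMem_mem (by grind) (by grind), F.e_e_rev]
    exact (F.punct_eq_e (by grind) i j hi).symm
  · rw [F.trans_notMem_mem hi hj, F.trans_mem_notMem (by grind) (by grind), F.e_e_rev]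
    exact (F.punct_eq_e (by grind) j i hj).symm
  · rcases H.eq_empty_or_nonempty with rfl | ⟨h, hh⟩
    · simp only [F.trans_empty]
    · rw [F.trans_symm hij (F.punct H a), F.trans_notMem_notMem hj hi hh,
        F.trans_notMem_notMem hi hj hh]
      exact F.punct_eq rfl h hh (F.tr_tr (by grind) hij)

/-- The cases record which of `i`, `j`, `m` are holes. If one of them is, values just move through
it; only when none is does `mgr` enter in full, through `tr_tr_rel`. -/
theorem trans_conj (hij : i ≠ j) (hjm : j ≠ m) (hmi : m ≠ i) (x : F.Punctured) :
    F.trans j m (F.trans i j x) = F.trans i j (F.trans m i x) := by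
  induction x using Quot.ind with | mk x =>
  obtain ⟨H, a⟩ := x
  change F.trans j m (F.trans i j (F.punct H a)) = F.trans i j (F.trans m i (F.punct H a))
  have path : ∀ {p q r : Fin n} {b : W}, p ≠ q → q ≠ r → r ≠ p →
      F.rel r (F.e p q b) (F.e p r (F.e r q b)) := by
    intro p q r b hpq hqr hrp
    rw [← F.e_eq_of_E hpq hrp.symm (F.E_symm (F.e_E r q b))]
    exact F.rel_e hrp hqr.symm (F.e_rel r q b)
  by_cases hi : i ∈ H <;> by_cases hj : j ∈ H <;> by_cases hm : m ∈ H
  · simp only [F.trans_mem_mem hi hj, F.trans_mem_mem hj hm, F.trans_mem_mem hm hi]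
  · rw [F.trans_mem_mem hi hj, F.trans_mem_notMem hj hm, F.trans_notMem_mem hm hi,
      F.trans_notMem_mem (by grind) (by grind)]
    exact F.punct_eq (by grind) i (by grind) (path hjm hmi hij)
  · rw [F.trans_mem_notMem hi hj, F.trans_mem_mem (by grind) (by grind), F.trans_mem_mem hm hi,
      F.trans_mem_notMem hi hj]
  · rw [F.trans_mem_notMem hi hj, F.trans_mem_notMem (H := insert j (H.erase i)) (by grind)
      (by grind), F.trans_notMem_mem hm hi,
      F.trans_notMem_notMem (H := insert m (H.erase i)) (h := m) (by grind) (by grind) (by grind),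
      tr, F.e_e_rev (i := i) (j := m), F.e_e_same hij]
    congr 1
    grind
  · rw [F.trans_notMem_mem hi hj, F.trans_notMem_mem (by grind) (by grind),
      F.trans_mem_notMem hm hi, F.trans_mem_mem (by grind) (by grind)]
    exact F.punct_eq (by grind) j (by grind) (rel_symm (path hmi hij hjm))
  · rw [F.trans_notMem_mem hi hj,
      F.trans_notMem_notMem (H := insert i (H.erase j)) (h := i) (by grind) (by grind) (by grind),
      F.trans_notMem_notMem hm hi hj, F.trans_notMem_mem hi hj, tr, tr, F.e_e_rev (i := j) (j := i),
      F.e_e_same hjm, F.e_e_rev (i := i) (j := j)]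
    exact F.punct_eq rfl i (by grind) (F.e_rel i j _)
  · rw [F.trans_notMem_notMem hi hj hm, F.trans_notMem_mem hj hm, F.trans_mem_notMem hm hi,
      F.trans_mem_notMem (H := insert i (H.erase m)) (by grind) (by grind), tr, F.e_e_rev]
    exact F.punct_eq (by grind) j (by grind) (F.e_rel' j m _)
  · rcases H.eq_empty_or_nonempty with rfl | ⟨h, hh⟩
    · simp only [F.trans_empty]
    · rw [F.trans_notMem_notMem hi hj hh, F.trans_notMem_notMem hj hm hh,
        F.trans_notMem_notMem hm hi hh, F.trans_notMem_notMem hi hj hh]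
      exact F.punct_eq rfl h hh
        (F.tr_tr_rel (by grind) (by grind) (by grind) hij hjm hmi)

/-- The transposition of `i` and `j` as a permutation of the punctured points. -/
noncomputable def transPerm (i j : Fin n) : Equiv.Perm F.Punctured :=
  if hij : i = j then 1 else
    ⟨F.trans i j, F.trans i j, F.trans_trans hij, F.trans_trans hij⟩

theorem transPerm_apply (hij : i ≠ j) (x : F.Punctured) : F.transPerm i j x = F.trans i j x := by
  rw [transPerm, dif_neg hij]; rfl

theorem swapFamily_transPerm : SwapFamily F.transPerm where
  symm i j hij := by
    ext x
    rw [F.transPerm_apply hij, F.transPerm_apply hij.symm, F.trans_symm hij]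
  sq i j hij := by
    ext x
    simp only [Equiv.Perm.mul_apply, F.transPerm_apply hij, F.trans_trans hij, Equiv.Perm.one_apply]
  conj i j m hij hjm hmi := by
    ext x
    simp only [Equiv.Perm.mul_apply, F.transPerm_apply hij, F.transPerm_apply hjm,
      F.transPerm_apply hmi]
    have h1 := F.trans_conj hij hjm hmi
    -- This is `h1` with both sides inverted, all maps being involutions.
    have h2 : ∀ y, F.trans i j (F.trans j m y) = F.trans m i (F.trans i j y) := by
      intro y
      have h3 := h1 (F.trans m i (F.trans i j y))
      rw [F.trans_trans hmi, F.trans_trans hij] at h3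
      have h4 := h1 (F.trans i j (F.trans j m y))
      rw [F.trans_trans hij, F.trans_trans hjm] at h4
      have h5 := congrArg (fun z => F.trans m i (F.trans i j z)) h4
      simpa only [F.trans_trans hij, F.trans_trans hmi] using h5.symm
    exact h2 x

end Frame

/-! ### Words in the replacements -/

/-- The transformation `[i_1/j_1] ∘ ⋯ ∘ [i_m/j_m]` of the word `(i_1, j_1), …, (i_m, j_m)`. -/
def wmap {n : ℕ} : List (Fin n × Fin n) → Fin n → Fin n
  | [] => id
  | p :: w => repl p.1 p.2 ∘ wmap w

theorem wmap_append {n : ℕ} (w v : List (Fin n × Fin n)) : wmap (w ++ v) = wmap w ∘ wmap v := by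
  induction w with
  | nil => rfl
  | cons p w ih => rw [List.cons_append, wmap, ih, wmap, Function.comp_assoc]

theorem repl_of_ne {n : ℕ} {i j l : Fin n} (h : l ≠ i) : repl i j l = l :=
  Function.update_of_ne h _ _

theorem repl_self {n : ℕ} (i j : Fin n) : repl i j i = j := Function.update_self _ _ _

theorem repl_same {n : ℕ} (i : Fin n) : repl i i = id := Function.update_eq_self i id

theorem repl_comp_of_avoid {n : ℕ} {i j : Fin n} {τ : Fin n → Fin n} (h : ∀ l, τ l ≠ i) :
    repl i j ∘ τ = τ := funext fun l => repl_of_ne (h l)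

theorem wmap_retract {n : ℕ} {r : Fin n → Fin n} (hr : ∀ l, r (r l) = r l) (L : List (Fin n))
    (l : Fin n) : wmap (L.map fun l => (l, r l)) l = if l ∈ L then r l else l := by
  induction L with
  | nil => simp [wmap]
  | cons x L ih =>
    simp only [List.map_cons, wmap, Function.comp_apply, ih, repl, Function.update_apply, id]
    grind

namespace Frame

variable {n : ℕ} {W : Type u} (F : Frame n W)

/-- The action of a word on a point. -/
def act : List (Fin n × Fin n) → W → W
  | [], a => a
  | p :: w, a => act w (F.e p.1 p.2 a)

theorem act_append (w v : List (Fin n × Fin n)) (a : W) :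
    F.act (w ++ v) a = F.act v (F.act w a) := by
  induction w generalizing a with
  | nil => rfl
  | cons p w ih => exact ih _

theorem E_act_iff (w : List (Fin n × Fin n)) (l m : Fin n) (a : W) :
    F.E l m (F.act w a) ↔ F.E (wmap w l) (wmap w m) a := by
  induction w generalizing a with
  | nil => rfl
  | cons p w ih => rw [act, ih, F.E_e_iff]; rfl

theorem act_eq_self {w : List (Fin n × Fin n)} {a : W} (h : ∀ p ∈ w, F.E p.1 p.2 a) :
    F.act w a = a := by
  induction w with
  | nil => rfl
  | cons p w ih =>
    rw [act, F.e_eq_self (h p (by simp))]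
    exact ih fun q hq => h q (by simp [hq])

/-- The action of permutations on punctured points. -/
noncomputable def permHom : Equiv.Perm (Fin n) →* Equiv.Perm F.Punctured :=
  F.swapFamily_transPerm.exists_hom.choose

theorem permHom_swap {i j : Fin n} (hij : i ≠ j) :
    F.permHom (Equiv.swap i j) = F.transPerm i j :=
  F.swapFamily_transPerm.exists_hom.choose_spec i j hij

/-- Such a permutation is a product of transpositions of two holes, each of which acts trivially. -/
theorem permHom_fix {T : Finset (Fin n)} {ρ : Equiv.Perm (Fin n)} (hρ : ∀ t ∈ T, ρ t = t)
    (a : W) : F.permHom ρ (F.punct Tᶜ a) = F.punct Tᶜ a := by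
  have h2 : ∀ x, ρ x ≠ x → x ∉ T := fun x hx hT => hx (hρ x hT)
  have h1 : ∀ x, ρ x ∉ T ↔ x ∉ T := by
    intro x
    constructor
    · intro h hT; exact h (by rwa [hρ x hT])
    · intro h hT
      have := ρ.injective (hρ _ hT)
      exact h (by rwa [this] at hT)
  rw [← Equiv.Perm.ofSubtype_subtypePerm (p := fun x => x ∉ T) h1 h2]
  generalize ρ.subtypePerm (p := fun x => x ∉ T) h1 = σ
  induction σ using Equiv.Perm.swap_induction_on with
  | one => simp
  | swap_mul σ x y hxy ih =>
    have hxy' : (x : Fin n) ≠ y := fun h => hxy (Subtype.ext h)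
    rw [map_mul, map_mul, Equiv.Perm.mul_apply, ih, Equiv.Perm.ofSubtype_swap_eq,
      F.permHom_swap hxy', F.transPerm_apply hxy',
      F.trans_mem_mem (Finset.mem_compl.2 x.2) (Finset.mem_compl.2 y.2)]

/-- If `i` is kept, injectivity makes `j` a hole, and `[i/j]` acts like the transposition that moves
this hole. If `i` is a hole, only ignored content changes. The inverse appears because words act on
points contravariantly. -/
theorem exists_perm_repl (i j : Fin n) (T : Finset (Fin n)) (hT : Set.InjOn (repl i j) T) :
    ∃ σ : Equiv.Perm (Fin n), (∀ t ∈ T, σ t = repl i j t) ∧ ∀ a,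
      F.permHom σ⁻¹ (F.punct (T.image (repl i j))ᶜ a) = F.punct Tᶜ (F.e i j a) := by
  by_cases hij : i = j
  · subst hij
    refine ⟨1, fun t _ => by simp [repl_same], fun a => ?_⟩
    simp [repl_same, F.e_self]
  by_cases hi : i ∈ T
  · have hj : j ∉ T := by
      intro hj
      exact hij (hT hi hj (by rw [repl_self, repl_of_ne (Ne.symm hij)]))
    have him : T.image (repl i j) = insert j (T.erase i) := by
      ext x
      simp only [Finset.mem_image, repl, Function.update_apply, id]
      grind
    refine ⟨Equiv.swap i j, fun t ht => ?_, fun a => ?_⟩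
    · rw [Equiv.swap_apply_def]
      simp only [repl, Function.update_apply, id]
      grind
    · rw [Equiv.swap_inv, F.permHom_swap hij, F.transPerm_apply hij, him,
        F.trans_mem_notMem (by grind [Finset.mem_compl]) (by grind [Finset.mem_compl])]
      congr 1
      grind [Finset.mem_compl]
  · have him : T.image (repl i j) = T := by
      ext x
      simp only [Finset.mem_image, repl, Function.update_apply, id]
      grind
    refine ⟨1, fun t ht => ?_, fun a => ?_⟩
    · rw [repl_of_ne (by rintro rfl; exact hi ht)]; rfl
    · rw [him, inv_one, map_one, Equiv.Perm.one_apply]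
      exact F.punct_eq rfl i (Finset.mem_compl.2 hi) (F.e_rel i j a)

theorem exists_perm_wmap (w : List (Fin n × Fin n)) (T : Finset (Fin n))
    (hT : Set.InjOn (wmap w) T) :
    ∃ σ : Equiv.Perm (Fin n), (∀ t ∈ T, σ t = wmap w t) ∧ ∀ a,
      F.permHom σ⁻¹ (F.punct (T.image (wmap w))ᶜ a) = F.punct Tᶜ (F.act w a) := by
  induction w with
  | nil => exact ⟨1, fun t _ => rfl, fun a => by simp [wmap, act]⟩
  | cons p w ih =>
    obtain ⟨π, h1, h2⟩ := ih fun x hx y hy hxy => hT hx hy (congrArg (repl p.1 p.2) hxy)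
    obtain ⟨σ, h3, h4⟩ := F.exists_perm_repl p.1 p.2 (T.image (wmap w)) (by
      rw [Finset.coe_image]
      rintro _ ⟨x, hx, rfl⟩ _ ⟨y, hy, rfl⟩ hxy
      rw [hT hx hy hxy])
    refine ⟨σ * π, fun t ht => ?_, fun a => ?_⟩
    · rw [Equiv.Perm.mul_apply, h1 t ht, h3 _ (Finset.mem_image_of_mem _ ht)]; rfl
    · rw [mul_inv_rev, map_mul, Equiv.Perm.mul_apply, wmap, ← Finset.image_image, h4, h2]; rfl

theorem punct_act_eq {w v : List (Fin n × Fin n)} (hwv : wmap w = wmap v) {T : Finset (Fin n)}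
    (hT : Set.InjOn (wmap w) T) (a : W) : F.punct Tᶜ (F.act w a) = F.punct Tᶜ (F.act v a) := by
  obtain ⟨π, h1, h2⟩ := F.exists_perm_wmap w T hT
  obtain ⟨σ, h3, h4⟩ := F.exists_perm_wmap v T (hwv ▸ hT)
  have h5 : ∀ t ∈ T, (π⁻¹ * σ) t = t := by
    intro t ht
    rw [Equiv.Perm.mul_apply, Equiv.Perm.inv_eq_iff_eq, h1 t ht, h3 t ht, hwv]
  rw [← F.permHom_fix h5 (F.act v a), ← h4, ← h2, ← Equiv.Perm.mul_apply, ← map_mul, hwv,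
    mul_inv_cancel_right]

/-- Refilling the hole `h` from a kept place erases a difference at `h`, and refilling other holes
does not spread it, since they never read from a hole. -/
theorem act_retract_congr {r : Fin n → Fin n} {H : Finset (Fin n)} (hr : ∀ l ∈ H, r l ∉ H)
    {h : Fin n} {a b : W} {L : List (Fin n)} (hL : ∀ l ∈ L, l ∈ H) (hh : h ∈ L)
    (hab : F.rel h a b) :
    F.act (L.map fun l => (l, r l)) a = F.act (L.map fun l => (l, r l)) b := by
  induction L generalizing a b with
  | nil => simp at hh
  | cons l L ih =>
    have hl : l ∈ H := hL l (by simp)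
    have hh' : h ∈ H := hL h hh
    have hrl := hr l hl
    simp only [List.map_cons, act]
    by_cases hhl : h = l
    · subst hhl
      rw [F.e_congr (by grind) hab]
    · exact ih (fun l hl => hL l (by simp [hl])) (by grind) (F.rel_e hhl (by grind) hab)

theorem eq_of_punct_eq {r : Fin n → Fin n} {H : Finset (Fin n)} (hr : ∀ l ∈ H, r l ∉ H) {a b : W}
    (ha : ∀ l ∈ H, F.E l (r l) a) (hb : ∀ l ∈ H, F.E l (r l) b)
    (hab : F.punct H a = F.punct H b) : a = b := by
  have key : ∀ p q, Relation.EqvGen F.HoleRel p q → p.1 = q.1 ∧ (p.1 = H →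
      F.act (H.toList.map fun l => (l, r l)) p.2 = F.act (H.toList.map fun l => (l, r l)) q.2) := by
    intro p q hpq
    induction hpq with
    | rel p q hpq =>
      obtain ⟨H', h, a, b, hh, hr'⟩ := hpq
      refine ⟨rfl, fun hH => ?_⟩
      simp only at hH
      subst hH
      exact F.act_retract_congr hr (fun l hl => Finset.mem_toList.1 hl) (Finset.mem_toList.2 hh) hr'
    | refl p => exact ⟨rfl, fun _ => rfl⟩
    | symm p q _ ih => exact ⟨ih.1.symm, fun h => (ih.2 (ih.1.trans h)).symm⟩
    | trans p q s _ _ ih ih' =>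
      exact ⟨ih.1.trans ih'.1, fun h => (ih.2 h).trans (ih'.2 (ih.1.symm.trans h))⟩
  have h1 := (key _ _ (Quot.eqvGen_exact hab)).2 rfl
  rwa [F.act_eq_self (by simpa using ha), F.act_eq_self (by simpa using hb)] at h1

/-- The action of a word depends on its transformation only. -/
theorem act_congr {w v : List (Fin n × Fin n)} (hwv : wmap w = wmap v) (a : W) :
    F.act w a = F.act v a := by
  classical
  -- `T` is a transversal of the kernel of `wmap w`; each place off `T` repeats, after the action,
  -- the place `r l` in `T`.
  obtain ⟨T, himg, hinj⟩ := Set.exists_image_eq_and_injOn Set.univ (wmap w)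
  lift T to Finset (Fin n) using T.toFinite
  have hex : ∀ l, ∃ t ∈ T, wmap w t = wmap w l := fun l => by
    have : wmap w l ∈ wmap w '' (T : Set (Fin n)) := himg ▸ Set.mem_image_of_mem _ (Set.mem_univ l)
    simpa using this
  choose r hrT hr using hex
  refine F.eq_of_punct_eq (H := Tᶜ) (r := r) (fun l _ => by simpa using hrT l) (fun l _ => ?_)
    (fun l _ => ?_) (F.punct_act_eq hwv hinj a)
  · rw [F.E_act_iff, hr]; exact F.E_refl _ _
  · rw [F.E_act_iff, ← hwv, hr]; exact F.E_refl _ _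

/-- A transformation that omits `p` is unchanged by prefixing a replacement of `p`, which overwrites
the only place where the points differ. -/
theorem act_congr_of_rel {w : List (Fin n × Fin n)} {p : Fin n} (hp : ∀ l, wmap w l ≠ p) {a b : W}
    (hab : F.rel p a b) : F.act w a = F.act w b := by
  have h : wmap ((p, wmap w p) :: w) = wmap w := repl_comp_of_avoid hp
  rw [← F.act_congr h a, ← F.act_congr h b, act, act, F.e_congr (hp p).symm hab]

/-- A system of representatives of the kernel of the point `a`. -/
noncomputable def kerRep (a : W) (l : Fin n) : Fin n :=
  (Quotient.mk (⟨fun l m => F.E l m a, fun l => F.E_refl l a, F.E_symm, F.E_trans⟩ : Setoid (Fin n))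
    l).out

theorem E_kerRep (a : W) (l : Fin n) : F.E (F.kerRep a l) l a :=
  Quotient.mk_out (s := ⟨fun l m => F.E l m a, fun l => F.E_refl l a, F.E_symm, F.E_trans⟩) l

theorem kerRep_eq_iff {a : W} {l m : Fin n} : F.kerRep a l = F.kerRep a m ↔ F.E l m a := by
  constructor
  · intro h
    exact F.E_trans (F.E_symm (F.E_kerRep a l)) (h ▸ F.E_kerRep a m)
  · intro h
    exact congrArg Quotient.out (Quotient.sound
      (s := ⟨fun l m => F.E l m a, fun l => F.E_refl l a, F.E_symm, F.E_trans⟩) h)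

/-- The word `κ` retracts each place to the representative of its class in the kernel of `a`. It
fixes `a`, and prefixing it makes the two transformations equal. -/
theorem act_congr_mod {w v : List (Fin n × Fin n)} {a : W}
    (hwv : ∀ l, F.E (wmap w l) (wmap v l) a) : F.act w a = F.act v a := by
  let κ := (List.finRange n).map fun l => (l, F.kerRep a l)
  have h1 : F.act κ a = a := F.act_eq_self fun p hp => by
    obtain ⟨l, -, rfl⟩ := List.mem_map.1 hp
    exact F.E_symm (F.E_kerRep a l)
  have h2 : wmap κ = F.kerRep a := funext fun l => by
    rw [wmap_retract (fun l => F.kerRep_eq_iff.2 (F.E_kerRep a l))]; simp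
  rw [← h1, ← F.act_append, ← F.act_append]
  apply F.act_congr
  rw [wmap_append, wmap_append, h2]
  exact funext fun l => F.kerRep_eq_iff.2 (hwv l)

end Frame

/-! ### Unravelling a frame -/

/-- Paths: from a point, steps permute the places and then change the place `i`. -/
inductive Path (n : ℕ) (W : Type u) : Type u
  | root (a : W) : Path n W
  | step (p : Path n W) (π : Equiv.Perm (Fin n)) (i : Fin n) (b : W) : Path n W

namespace Path

variable {n : ℕ} {W : Type u}

/-- The number of steps of a path. -/
def len : Path n W → ℕ
  | root _ => 0
  | step p _ _ _ => p.len + 1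

/-- The point reached by a path. -/
def label : Path n W → W
  | root a => a
  | step _ _ _ b => b

end Path

namespace Frame

variable {n : ℕ} {W : Type u} (F : Frame n W)

/-- The point `b` behaves as the point `a` with its places permuted by `π`. -/
def Permuted (a : W) (π : Equiv.Perm (Fin n)) (b : W) : Prop :=
  (∀ p q, p ≠ q → ∃ w, wmap w = π ∘ repl p q ∧ F.e p q b = F.act w a) ∧
    ∀ l m, F.E l m b ↔ F.E (π l) (π m) a

/-- A choice of permuted points, for the permutations in a submonoid. -/
structure PermChoice where
  P : Submonoid (Equiv.Perm (Fin n))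
  pm : W → Equiv.Perm (Fin n) → W
  pm_one : ∀ a, pm a 1 = a
  pm_permuted : ∀ a, ∀ π ∈ P, F.Permuted a π (pm a π)

open Classical in
/-- The sequence of values at the end of a path; a value is the path that created it, with a place. -/
noncomputable def tuple : Path n W → Fin n → Path n W × Fin n
  | .root a, l => (.root a, F.kerRep a l)
  | .step p π i b, l =>
    if l = i then
      if h : ∃ j, i ≠ j ∧ F.E i j b then tuple p (π h.choose) else (.step p π i b, i)
    else tuple p (π l)

variable {F}

theorem tuple_step_of_E {p : Path n W} {π : Equiv.Perm (Fin n)} {i : Fin n} {b : W}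
    (h : ∃ j, i ≠ j ∧ F.E i j b) :
    ∃ j, i ≠ j ∧ F.E i j b ∧ ∀ l, F.tuple (.step p π i b) l = F.tuple p (π (repl i j l)) := by
  refine ⟨h.choose, h.choose_spec.1, h.choose_spec.2, fun l => ?_⟩
  by_cases hl : l = i
  · subst hl; simp [tuple, h, repl_self]
  · simp [tuple, hl, repl_of_ne hl]

theorem tuple_step_self {p : Path n W} {π : Equiv.Perm (Fin n)} {i : Fin n} {b : W}
    (h : ¬ ∃ j, i ≠ j ∧ F.E i j b) : F.tuple (.step p π i b) i = (.step p π i b, i) := by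
  rw [tuple, if_pos rfl, dif_neg h]

theorem tuple_step_of_ne {p : Path n W} {π : Equiv.Perm (Fin n)} {i l : Fin n} {b : W}
    (h : l ≠ i) : F.tuple (.step p π i b) l = F.tuple p (π l) := by
  rw [tuple, if_neg h]

theorem tuple_fst (p : Path n W) (l : Fin n) :
    (F.tuple p l).1 = p ∨ (F.tuple p l).1.len < p.len := by
  induction p generalizing l with
  | root a => exact Or.inl rfl
  | step p π i b ih =>
    have key : ∀ m, (F.tuple p m).1.len < (Path.step p π i b).len := fun m => by
      rcases ih m with h | h
      · rw [h]; exact Nat.lt_succ_self _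
      · exact h.trans (Nat.lt_succ_self _)
    by_cases hl : l = i
    · subst hl
      by_cases h : ∃ j, l ≠ j ∧ F.E l j b
      · obtain ⟨j, -, -, hj⟩ := tuple_step_of_E (p := p) (π := π) h
        rw [hj]; exact Or.inr (key _)
      · rw [tuple_step_self h]; exact Or.inl rfl
    · rw [tuple_step_of_ne hl]; exact Or.inr (key _)

/-- Nontrivial permutations are not transformations of words, so `Permuted` speaks of `π ∘ [p/q]`
only. A word omitting the place `s` absorbs a replacement of `s` and so reduces to that case. -/
theorem Permuted.act_eq {a b : W} {π : Equiv.Perm (Fin n)} (h : F.Permuted a π b)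
    {w : List (Fin n × Fin n)} {s : Fin n} (hs : ∀ l, wmap w l ≠ s) :
    ∃ u, wmap u = π ∘ wmap w ∧ F.act w b = F.act u a := by
  obtain ⟨u, hu, he⟩ := h.1 s (wmap w s) (hs s).symm
  refine ⟨u ++ w, ?_, ?_⟩
  · rw [wmap_append, hu, Function.comp_assoc, repl_comp_of_avoid hs]
  · rw [F.act_congr_of_rel hs (F.e_rel s (wmap w s) b), he, F.act_append]

theorem permuted_one (a : W) : F.Permuted a 1 a :=
  ⟨fun p q _ => ⟨[(p, q)], rfl, rfl⟩, fun _ _ => Iff.rfl⟩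

theorem Permuted.mul {a b c : W} {π σ : Equiv.Perm (Fin n)} (h : F.Permuted a π b)
    (h' : F.Permuted b σ c) : F.Permuted a (π * σ) c := by
  refine ⟨fun p q hpq => ?_, fun l m => (h'.2 l m).trans (h.2 _ _)⟩
  obtain ⟨w, hw, he⟩ := h'.1 p q hpq
  obtain ⟨u, hu, he'⟩ := h.act_eq (w := w) (s := σ p) fun l => by
    rw [hw, Function.comp_apply]
    intro h
    have h1 := σ.injective h
    by_cases hl : l = p
    · rw [hl, repl_self] at h1; exact hpq h1.symm
    · rw [repl_of_ne hl] at h1; exact hl h1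
  refine ⟨u, ?_, he.trans he'⟩
  rw [hu, hw]; rfl

namespace PermChoice

variable (C : F.PermChoice)

/-- Every step goes to a point that agrees with the permuted point off the changed place. -/
def Valid : Path n W → Prop
  | .root _ => True
  | .step p π i b => Valid p ∧ π ∈ C.P ∧ F.rel i (C.pm p.label π) b

variable {C}

/-- A fresh value differs from all older ones because the path it names is longer than theirs. -/
theorem tuple_eq_iff {p : Path n W} (hp : C.Valid p) (l m : Fin n) :
    F.tuple p l = F.tuple p m ↔ F.E l m p.label := by
  induction p generalizing l m with
  | root a => simp [tuple, F.kerRep_eq_iff, Path.label]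
  | step p π i b ih =>
    obtain ⟨hp, hπ, hr⟩ := hp
    have ih' : ∀ l m, F.tuple p (π l) = F.tuple p (π m) ↔ F.E l m (C.pm p.label π) := fun l m => by
      rw [ih hp, (C.pm_permuted _ π hπ).2]
    change _ ↔ F.E l m b
    by_cases h : ∃ j, i ≠ j ∧ F.E i j b
    · obtain ⟨j, hij, hE, hj⟩ := tuple_step_of_E (p := p) (π := π) h
      rw [hj, hj, ih', ← F.E_e_iff, F.eq_e hij hr hE]
    · have key : ∀ m, m ≠ i → (F.tuple (.step p π i b) i ≠ F.tuple (.step p π i b) m) := by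
        intro m hm he
        rw [tuple_step_self h, tuple_step_of_ne hm] at he
        have h1 : (F.tuple p (π m)).1.len = p.len + 1 := by rw [← he]; rfl
        rcases F.tuple_fst p (π m) with h2 | h2
        · rw [h2] at h1; omega
        · omega
      by_cases hl : l = i <;> by_cases hm : m = i
      · rw [hl, hm]; exact ⟨fun _ => F.E_refl _ _, fun _ => rfl⟩
      · subst hl
        exact ⟨fun he => absurd he (key m hm), fun hE => absurd ⟨m, Ne.symm hm, hE⟩ h⟩
      · subst hm
        exact ⟨fun he => absurd he.symm (key l hl), fun hE => absurd ⟨l, Ne.symm hl, F.E_symm hE⟩ h⟩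
      · rw [tuple_step_of_ne hl, tuple_step_of_ne hm, ih',
          F.E_iff_of_rel (Ne.symm hl) (Ne.symm hm) hr]

theorem exists_word_of_step {p : Path n W} {π : Equiv.Perm (Fin n)} {i : Fin n} {b : W}
    (hp : C.Valid (.step p π i b)) {w : List (Fin n × Fin n)}
    (hw : ∀ l, (F.tuple (.step p π i b) (wmap w l)).1 ≠ .step p π i b) :
    ∃ w', (∀ l, F.tuple (.step p π i b) (wmap w l) = F.tuple p (wmap w' l)) ∧
      F.act w b = F.act w' p.label := by
  obtain ⟨-, hπ, hr⟩ := hp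
  by_cases h : ∃ j, i ≠ j ∧ F.E i j b
  · obtain ⟨j, hij, hE, hj⟩ := tuple_step_of_E (p := p) (π := π) h
    obtain ⟨u, hu, he⟩ := (C.pm_permuted p.label π hπ).1 i j hij
    refine ⟨u ++ w, fun l => ?_, ?_⟩
    · rw [hj, wmap_append, hu]; rfl
    · rw [F.act_append, ← he, F.eq_e hij hr hE]
  · have hi : ∀ l, wmap w l ≠ i := by
      intro l hl
      apply hw l
      rw [hl, tuple_step_self h]
    obtain ⟨u, hu, he⟩ := (C.pm_permuted p.label π hπ).act_eq hi
    refine ⟨u, fun l => ?_, ?_⟩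
    · rw [tuple_step_of_ne (hi l), hu]; rfl
    · rw [← he, F.act_congr_of_rel hi hr]

/-- If `p` is a different path, at least as long as `q`, then no value of `q` names `p`. Hence `w`
uses no value created by the last step of `p`, and this step can be dropped. For equal paths the
words agree modulo the kernel of the label. -/
theorem act_label_eq (i₀ : Fin n) (N : ℕ) : ∀ {p q : Path n W}, C.Valid p → C.Valid q →
    p.len + q.len < N → ∀ {w v : List (Fin n × Fin n)},
    (∀ l, F.tuple p (wmap w l) = F.tuple q (wmap v l)) → F.act w p.label = F.act v q.label := by
  induction N with
  | zero => intro p q _ _ h; omega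
  | succ N ih =>
    intro p q hp hq hN w v h
    wlog hle : q.len ≤ p.len generalizing p q w v with H
    · exact (H hq hp (by omega) (fun l => (h l).symm) (by omega)).symm
    by_cases hpq : p = q
    · subst hpq
      exact F.act_congr_mod fun l => (tuple_eq_iff hp _ _).1 (h l)
    have hne : ∀ l, (F.tuple p (wmap w l)).1 ≠ p := by
      intro l hl
      rw [h l] at hl
      rcases F.tuple_fst q (wmap v l) with h1 | h1
      · exact hpq (hl.symm.trans h1)
      · rw [hl] at h1; omega
    cases p with
    | root a => exact absurd rfl (hne i₀)
    | step p π i b =>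
      obtain ⟨w', hw', he⟩ := exists_word_of_step hp hne
      refine he.trans (ih hp.1 hq ?_ fun l => (hw' l).symm.trans (h l))
      simp only [Path.len] at hN ⊢
      omega

variable (C)

/-- The sequence `g` occurs in the unravelling with the label `a`. -/
def Lab (g : Fin n → Path n W × Fin n) (a : W) : Prop :=
  ∃ p π, C.Valid p ∧ π ∈ C.P ∧ g = F.tuple p ∘ π ∧ a = C.pm p.label π

variable {C} {g g' : Fin n → Path n W × Fin n} {a a' b : W}

theorem Lab.eq_iff (h : C.Lab g a) (l m : Fin n) : g l = g m ↔ F.E l m a := by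
  obtain ⟨p, π, hp, hπ, rfl, rfl⟩ := h
  rw [(C.pm_permuted _ π hπ).2]
  exact tuple_eq_iff hp _ _

theorem Lab.rel [Nontrivial (Fin n)] (h : C.Lab g a) (h' : C.Lab g' a') {i : Fin n}
    (hg : ∀ j, j ≠ i → g j = g' j) : F.rel i a a' := by
  obtain ⟨p, π, hp, hπ, rfl, rfl⟩ := h
  obtain ⟨q, ρ, hq, hρ, rfl, rfl⟩ := h'
  obtain ⟨j, hj⟩ := exists_ne i
  obtain ⟨u, hu, he⟩ := (C.pm_permuted p.label π hπ).1 i j hj.symm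
  obtain ⟨v, hv, he'⟩ := (C.pm_permuted q.label ρ hρ).1 i j hj.symm
  apply F.rel_of_e_eq (j := j)
  rw [he, he']
  refine act_label_eq i _ hp hq (Nat.lt_succ_self _) fun l => ?_
  rw [hu, hv]
  refine hg (repl i j l) ?_
  by_cases hl : l = i
  · rw [hl, repl_self]; exact hj
  · rw [repl_of_ne hl]; exact hl

theorem exists_tuple_fst_eq (i₀ : Fin n) {p : Path n W} (hp : Function.Injective (F.tuple p)) :
    ∃ l, (F.tuple p l).1 = p := by
  cases p with
  | root a => exact ⟨i₀, rfl⟩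
  | step p π i b =>
    by_cases h : ∃ j, i ≠ j ∧ F.E i j b
    · obtain ⟨j, hij, hE, hj⟩ := tuple_step_of_E (p := p) (π := π) h
      exact absurd (hp (by rw [hj, hj, repl_self, repl_of_ne hij.symm])) hij
    · exact ⟨i, by rw [tuple_step_self h]⟩

/-- An injective sequence contains a value naming its own path, so it determines the path and then
the permutation. Otherwise two places `l ≠ m` coincide; the labels are related by `rel l` and both
lie on the diagonal `E l m`, so they are equal. -/
theorem Lab.unique [Nontrivial (Fin n)] (h : C.Lab g a) (h' : C.Lab g a') : a = a' := by
  by_cases hg : Function.Injective g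
  · obtain ⟨p, π, hp, hπ, rfl, rfl⟩ := h
    obtain ⟨q, ρ, hq, hρ, he, rfl⟩ := h'
    have hpi : Function.Injective (F.tuple p) := by
      have := hg.comp π.symm.injective
      rwa [Function.comp_assoc, Equiv.self_comp_symm, Function.comp_id] at this
    have hqi : Function.Injective (F.tuple q) := by
      rw [he] at hg
      have := hg.comp ρ.symm.injective
      rwa [Function.comp_assoc, Equiv.self_comp_symm, Function.comp_id] at this
    obtain ⟨i₀, -⟩ := exists_pair_ne (Fin n)
    obtain ⟨l, hl⟩ := exists_tuple_fst_eq i₀ hpi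
    obtain ⟨m, hm⟩ := exists_tuple_fst_eq i₀ hqi
    have h1 : F.tuple q (ρ (π.symm l)) = F.tuple p l := by
      have := congrFun he (π.symm l)
      simpa using this.symm
    have h2 : F.tuple p (π (ρ.symm m)) = F.tuple q m := by
      have := congrFun he (ρ.symm m)
      simpa using this
    have hpq : p = q := by
      have h3 := F.tuple_fst q (ρ (π.symm l))
      have h4 := F.tuple_fst p (π (ρ.symm m))
      rw [h1, hl] at h3
      rw [h2, hm] at h4
      rcases h3 with h3 | h3
      · exact h3
      · rcases h4 with h4 | h4
        · exact h4.symm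
        · omega
    subst hpq
    have hπρ : π = ρ := Equiv.ext fun x => hpi (congrFun he x)
    rw [hπρ]
  · obtain ⟨l, m, hlm, hne⟩ : ∃ l m, g l = g m ∧ l ≠ m := by
      simpa [Function.Injective] using hg
    exact F.E_uniq hne (h.rel h' fun _ _ => rfl) ((h.eq_iff l m).1 hlm) ((h'.eq_iff l m).1 hlm)

theorem Lab.back (h : C.Lab g a) {i : Fin n} (hab : F.rel i a b) :
    ∃ g', C.Lab g' b ∧ ∀ j, j ≠ i → g' j = g j := by
  obtain ⟨p, π, hp, hπ, rfl, rfl⟩ := h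
  refine ⟨F.tuple (.step p π i b), ⟨.step p π i b, 1, ⟨hp, hπ, hab⟩, one_mem _, rfl, ?_⟩, ?_⟩
  · exact (C.pm_one b).symm
  · intro j hj
    exact tuple_step_of_ne hj

end PermChoice

variable (F)

/-- A representation of a frame by sequences of length `n`. -/
structure Representation (P : Submonoid (Equiv.Perm (Fin n))) where
  U : Type u
  V : Set (Fin n → U)
  lab : V → W
  eq_iff : ∀ (f : V) i j, f.1 i = f.1 j ↔ F.E i j (lab f)
  rel : ∀ (f g : V) i, (∀ j, j ≠ i → g.1 j = f.1 j) → F.rel i (lab g) (lab f)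
  back : ∀ (f : V) i b, F.rel i (lab f) b → ∃ g : V, lab g = b ∧ ∀ j, j ≠ i → g.1 j = f.1 j
  surj : Function.Surjective lab
  comp_mem : ∀ f ∈ V, ∀ π ∈ P, f ∘ π ∈ V

variable {F}

/-- The unravelling of a frame represents it. -/
noncomputable def PermChoice.representation [Nontrivial (Fin n)] (C : F.PermChoice) :
    F.Representation C.P where
  U := Path n W × Fin n
  V := {g | ∃ a, C.Lab g a}
  lab g := g.2.choose
  eq_iff f i j := f.2.choose_spec.eq_iff i j
  rel f g i h := g.2.choose_spec.rel f.2.choose_spec h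
  back f i b h := by
    obtain ⟨g, hg, hgf⟩ := f.2.choose_spec.back h
    exact ⟨⟨g, b, hg⟩, Lab.unique (Exists.choose_spec (⟨b, hg⟩ : ∃ a, C.Lab g a)) hg, hgf⟩
  surj a := by
    have h : C.Lab (F.tuple (.root a)) a := ⟨.root a, 1, trivial, one_mem _, rfl, (C.pm_one a).symm⟩
    exact ⟨⟨_, a, h⟩, Lab.unique (Exists.choose_spec (⟨a, h⟩ : ∃ b, C.Lab _ b)) h⟩
  comp_mem f hf π hπ := by
    obtain ⟨a, p, σ, hp, hσ, rfl, -⟩ := hf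
    exact ⟨_, p, σ * π, hp, mul_mem hσ hπ, rfl, rfl⟩

theorem Representation.diagonalizable {P : Submonoid (Equiv.Perm (Fin n))}
    (R : F.Representation P) : Diagonalizable R.V := by
  intro f hf i j
  by_cases hij : i = j
  · subst hij; rw [repl_same]; exact hf
  obtain ⟨g, hg, hgf⟩ := R.back ⟨f, hf⟩ i _ (F.e_rel i j _)
  have h : g.1 i = g.1 j := by rw [R.eq_iff, hg]; exact F.e_E i j _
  have hfg : f ∘ repl i j = g.1 := by
    funext l
    by_cases hl : l = i
    · subst hl
      rw [Function.comp_apply, repl_self, h, hgf j (Ne.symm hij)]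
    · rw [Function.comp_apply, repl_of_ne hl, hgf l hl]
  rw [hfg]
  exact g.2

end Frame

/-! ### Permuted points: from transpositions to all permutations -/

namespace Frame

variable {n : ℕ} {W : Type u} {F : Frame n W}

/-- The hypotheses are what the factors of (Ax12) say about ultrafilters. Up to the place `p`, they
exhibit `a'` as the image of `a` under a word that agrees with the transposition off `p`. For `3 ≤
n` any two places avoid some `p`, so the diagonals of `a'` follow; in dimension two they need `hE`.
-/
theorem permuted_swap {a a' : W} {i j : Fin n} (hij : i ≠ j) (h1 : F.rel j a (F.e i j a'))
    (h2 : F.rel i a (F.e j i a'))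
    (h3 : ∀ k, k ≠ i → k ≠ j → F.rel k a (F.tr k i j a'))
    (hE : 3 ≤ n ∨ ∀ l m, F.E l m a' ↔ F.E (Equiv.swap i j l) (Equiv.swap i j m) a) :
    F.Permuted a (Equiv.swap i j) a' := by
  have h1' := F.eq_e hij.symm h1 (F.E_symm (F.e_E i j a'))
  have h2' := F.eq_e hij h2 (F.E_symm (F.e_E j i a'))
  have key : ∀ p, ∃ u, (∀ l, l ≠ p → wmap u l = Equiv.swap i j l) ∧ F.rel p a' (F.act u a) := by
    intro p
    by_cases hpi : p = i
    · subst hpi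
      refine ⟨[(j, p)], fun l hl => ?_, ?_⟩
      · simp only [wmap, Function.comp_id, repl, Function.update_apply, id, Equiv.swap_apply_def, hl,
          if_false]
      · change F.rel p a' (F.e j p a)
        rw [h1']
        exact F.e_rel p j a'
    by_cases hpj : p = j
    · subst hpj
      refine ⟨[(i, p)], fun l hl => ?_, ?_⟩
      · simp only [wmap, Function.comp_id, repl, Function.update_apply, id, Equiv.swap_apply_def, hl,
          if_false]
      · change F.rel p a' (F.e i p a)
        rw [h2']
        exact F.e_rel p i a'
    · refine ⟨[(p, j), (j, i), (i, p)], fun l hl => ?_, ?_⟩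
      · simp only [wmap, Function.comp_id, repl, Function.update_apply, id, Equiv.swap_apply_def,
          Function.comp_apply]
        grind
      · change F.rel p a' (F.tr p j i a)
        rw [F.tr_congr hpj (h3 p hpi hpj)]
        exact rel_symm (F.tr_tr hpi hij.symm)
  refine ⟨fun p q hpq => ?_, fun l m => ?_⟩
  · obtain ⟨u, hu, hr⟩ := key p
    refine ⟨u ++ [(p, q)], ?_, ?_⟩
    · rw [wmap_append]
      funext l
      refine hu (repl p q l) ?_
      by_cases hl : l = p
      · rw [hl, repl_self]; exact hpq.symm
      · rw [repl_of_ne hl]; exact hl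
    · rw [F.act_append, F.e_congr hpq hr]; rfl
  · rcases hE with hE | hE
    · obtain ⟨p, hp⟩ : ∃ p, p ∉ ({l, m} : Finset (Fin n)) := by
        by_contra hcon
        push Not at hcon
        have h4 : (Finset.univ : Finset (Fin n)).card ≤ ({l, m} : Finset (Fin n)).card :=
          Finset.card_le_card fun x _ => hcon x
        have h5 := Finset.card_le_two (a := l) (b := m)
        rw [Finset.card_univ, Fintype.card_fin] at h4
        omega
      obtain ⟨u, hu, hr⟩ := key p
      simp only [Finset.mem_insert, Finset.mem_singleton, not_or] at hp
      rw [F.E_iff_of_rel hp.1 hp.2 hr, F.E_act_iff, hu l (Ne.symm hp.1), hu m (Ne.symm hp.2)]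
    · exact hE l m

theorem exists_permuted (h : ∀ a, ∀ i j : Fin n, i ≠ j → ∃ b, F.Permuted a (Equiv.swap i j) b)
    (a : W) (π : Equiv.Perm (Fin n)) : ∃ b, F.Permuted a π b := by
  induction π using Equiv.Perm.swap_induction_on generalizing a with
  | one => exact ⟨a, permuted_one a⟩
  | swap_mul π i j hij ih =>
    obtain ⟨b, hb⟩ := h a i j hij
    obtain ⟨b', hb'⟩ := ih b
    exact ⟨b', hb.mul hb'⟩

variable (F)

/-- The choice of permuted points for the identity only. -/
def PermChoice.trivial : F.PermChoice where
  P := ⊥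
  pm a _ := a
  pm_one _ := rfl
  pm_permuted a π hπ := by
    rw [Submonoid.mem_bot.1 hπ]
    exact permuted_one a

variable {F}

theorem PermChoice.exists_top (h : ∀ a π, ∃ b, F.Permuted a π b) :
    ∃ C : F.PermChoice, C.P = ⊤ := by
  classical
  choose f hf using h
  -- `Permuted a 1 b` does not force `b = a`, so the value at the identity is set separately.
  exact ⟨⟨⊤, fun a π => if π = 1 then a else f a π, fun a => if_pos rfl, fun a π _ => by
    by_cases hπ : π = 1
    · simp only [hπ, if_true]; exact permuted_one a
    · simp only [hπ, if_false]; exact hf a π⟩, rfl⟩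

end Frame

/-! ### Ultrafilters of a Boolean algebra -/

/-- Ultrafilters of a Boolean algebra. -/
@[ext]
structure BoolUltrafilter (A : Type u) [BooleanAlgebra A] where
  carrier : Set A
  top_mem : ⊤ ∈ carrier
  inf_mem : ∀ {x y}, x ∈ carrier → y ∈ carrier → x ⊓ y ∈ carrier
  mem_of_le : ∀ {x y}, x ≤ y → x ∈ carrier → y ∈ carrier
  compl_mem_iff : ∀ {x}, xᶜ ∈ carrier ↔ x ∉ carrier

namespace BoolUltrafilter

variable {A : Type u} [BooleanAlgebra A]

instance : Membership A (BoolUltrafilter A) := ⟨fun u x => x ∈ u.carrier⟩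

variable {u v : BoolUltrafilter A} {x y : A}

theorem mem_top : ⊤ ∈ u := u.top_mem

theorem mem_inf (hx : x ∈ u) (hy : y ∈ u) : x ⊓ y ∈ u := u.inf_mem hx hy

theorem mono (h : x ≤ y) (hx : x ∈ u) : y ∈ u := u.mem_of_le h hx

theorem mem_compl : xᶜ ∈ u ↔ x ∉ u := u.compl_mem_iff

theorem not_mem_bot : ⊥ ∉ u := by
  rw [← mem_compl, compl_bot]; exact mem_top

theorem eq_of_subset (h : ∀ x ∈ u, x ∈ v) : u = v := by
  ext x
  refine ⟨h x, fun hx => ?_⟩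
  by_contra hxu
  exact mem_compl.1 (h _ (mem_compl.2 hxu)) hx

/-- The ultrafilter theorem. -/
theorem exists_of_directed {S : Set A} (hne : S.Nonempty)
    (hdir : ∀ x ∈ S, ∀ y ∈ S, ∃ z ∈ S, z ≤ x ⊓ y) (hbot : ⊥ ∉ S) :
    ∃ u : BoolUltrafilter A, ∀ x ∈ S, x ∈ u := by
  let Fl : Order.PFilter A := Order.IsPFilter.toPFilter (F := {x | ∃ s ∈ S, s ≤ x}) <| by
    refine Order.IsPFilter.of_def ?_ ?_ ?_
    · obtain ⟨s, hs⟩ := hne; exact ⟨s, s, hs, le_rfl⟩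
    · rintro x ⟨s, hs, hsx⟩ y ⟨t, ht, hty⟩
      obtain ⟨z, hz, hzst⟩ := hdir s hs t ht
      exact ⟨z, ⟨z, hz, le_rfl⟩, (hzst.trans inf_le_left).trans hsx,
        (hzst.trans inf_le_right).trans hty⟩
    · rintro x y hxy ⟨s, hs, hsx⟩
      exact ⟨s, hs, hsx.trans hxy⟩
  have hFl : ∀ x, x ∈ Fl ↔ ∃ s ∈ S, s ≤ x := fun x => Iff.rfl
  obtain ⟨J, hJ, -, hdisj⟩ := DistribLattice.prime_ideal_of_disjoint_filter_ideal
    (F := Fl) (I := Order.Ideal.principal ⊥) (by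
      rw [Set.disjoint_left]
      rintro x ⟨s, hs, hsx⟩ hx
      have hx' : x ≤ ⊥ := hx
      exact hbot (le_bot_iff.1 (hsx.trans hx') ▸ hs))
  rw [Set.disjoint_left] at hdisj
  have hproper := hJ.toIsProper
  refine ⟨⟨{x | x ∉ J}, hproper.top_notMem, ?_, ?_, ?_⟩, ?_⟩
  · intro x y hx hy hxy
    rcases hJ.mem_or_mem hxy with h | h
    · exact hx h
    · exact hy h
  · intro x y hxy hx hy
    exact hx (J.lower hxy hy)
  · intro x
    constructor
    · intro h hx
      exact h (hJ.mem_or_compl_mem.resolve_left hx)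
    · intro h hx
      have h' : x ∈ J := by simpa using h
      have := J.sup_mem h' hx
      rw [sup_compl_eq_top] at this
      exact hproper.top_notMem this
  · intro x hx hxJ
    exact hdisj ⟨x, hx, le_rfl⟩ hxJ

theorem exists_mem (hx : x ≠ ⊥) : ∃ u : BoolUltrafilter A, x ∈ u := by
  obtain ⟨u, hu⟩ := exists_of_directed (S := {x}) ⟨x, rfl⟩
    (by rintro _ rfl _ rfl; exact ⟨_, rfl, by simp⟩) (fun h => hx h.symm)
  exact ⟨u, hu x rfl⟩

end BoolUltrafilter

/-! ### Cylindrifications and substitutions -/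

section Algebra

variable {n : ℕ} {A : Type u} [BooleanAlgebra A] {c : Fin n → A → A} {d : Fin n → Fin n → A}

namespace BasicAxioms

variable (hb : BasicAxioms c d) (i j k : Fin n) {x y : A}
include hb

theorem c_mono (h : x ≤ y) : c i x ≤ c i y := by
  have h1 := hb.ax3 i x y
  rw [inf_eq_left.2 (h.trans (hb.ax2 i y))] at h1
  rw [h1]; exact inf_le_right

theorem c_top : c i ⊤ = ⊤ := top_le_iff.1 (hb.ax2 i ⊤)

theorem c_c (x : A) : c i (c i x) = c i x := by
  have h1 := hb.ax3 i ⊤ x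
  rwa [top_inf_eq, hb.c_top, top_inf_eq] at h1

theorem c_compl_c (x : A) : c i (c i x)ᶜ = (c i x)ᶜ := by
  refine le_antisymm ?_ (hb.ax2 i _)
  rw [le_compl_iff_disjoint_right, disjoint_iff, ← hb.ax3, compl_inf_eq_bot, hb.ax1]

theorem c_sup (x y : A) : c i (x ⊔ y) = c i x ⊔ c i y := by
  refine le_antisymm ?_ (sup_le (hb.c_mono i le_sup_left) (hb.c_mono i le_sup_right))
  have h1 : c i ((c i x)ᶜ ⊓ (c i y)ᶜ) = (c i x)ᶜ ⊓ (c i y)ᶜ := by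
    have := hb.ax3 i (c i x)ᶜ (c i y)ᶜ
    rwa [hb.c_compl_c, hb.c_compl_c] at this
  have h2 : c i (c i x ⊔ c i y) = c i x ⊔ c i y := by
    have := hb.c_compl_c i ((c i x)ᶜ ⊓ (c i y)ᶜ)
    rwa [h1, compl_inf, compl_compl, compl_compl] at this
  rw [← h2]
  exact hb.c_mono i (sup_le_sup (hb.ax2 i x) (hb.ax2 i y))

theorem sub_mono (h : x ≤ y) : sub c d i j x ≤ sub c d i j y := by
  unfold sub
  split_ifs
  · exact h
  · exact hb.c_mono i (inf_le_inf_right _ h)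

/-- By (Ax6), `c i (y ⊓ d i j)` lies below `y` on the diagonal; (Ax3) moves it inside the
cylindrification. This makes substitution multiplicative. -/
theorem c_inf_d_inf (hij : i ≠ j) (x y : A) :
    c i (x ⊓ d i j) ⊓ c i (y ⊓ d i j) ≤ c i (x ⊓ y ⊓ d i j) := by
  rw [← hb.ax3]
  apply hb.c_mono
  have h1 := hb.ax6 i j hij y
  refine le_inf (le_inf (inf_le_left.trans inf_le_left) ?_) (inf_le_left.trans inf_le_right)
  exact le_trans (le_inf inf_le_right (inf_le_left.trans inf_le_right)) h1

theorem sub_inf_le (x y : A) : sub c d i j x ⊓ sub c d i j y ≤ sub c d i j (x ⊓ y) := by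
  unfold sub
  split_ifs with hij
  · exact le_rfl
  · exact hb.c_inf_d_inf i j hij x y

theorem sub_bot : sub c d i j ⊥ = ⊥ := by
  unfold sub
  split_ifs with hij
  · rfl
  · rw [bot_inf_eq, hb.ax1]

theorem sub_sup (x y : A) : sub c d i j (x ⊔ y) = sub c d i j x ⊔ sub c d i j y := by
  unfold sub
  split_ifs with hij
  · rfl
  · rw [inf_sup_right, hb.c_sup]

end BasicAxioms

variable (hb : BasicAxioms c d) (hd : DiagAxioms c d) (i j k : Fin n) {x y : A}
include hb hd

/-- (Ax5) gives symmetry only where a third index exists. The case `d_jj` of (Ax9) together with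
(Ax6) works in every dimension. -/
theorem d_comm : d i j = d j i := by
  have key : ∀ i j, d i j ≤ d j i := by
    intro i j
    by_cases hij : i = j
    · rw [hij]
    have h1 := hd.ax9 j j i hij hij
    have h2 := hb.ax6 i j hij (d j i)
    rwa [← h1, hb.ax4, top_inf_eq] at h2
  exact le_antisymm (key i j) (key j i)

theorem c_d (hij : i ≠ j) : c i (d i j) = ⊤ := by
  have h1 := hd.ax9 j j i hij hij
  rw [hb.ax4] at h1
  exact top_le_iff.1 (h1.le.trans (hb.c_mono i inf_le_right))

theorem sub_top : sub c d i j ⊤ = ⊤ := by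
  unfold sub
  split_ifs with hij
  · rfl
  · rw [top_inf_eq, c_d hb hd i j hij]

/-- The ultrafilter of the elements whose substitution instances belong to `u`. -/
def subUltrafilter (u : BoolUltrafilter A) : BoolUltrafilter A where
  carrier := {x | sub c d i j x ∈ u}
  top_mem := by
    change sub c d i j ⊤ ∈ u
    rw [sub_top hb hd]; exact BoolUltrafilter.mem_top
  inf_mem hx hy := BoolUltrafilter.mono (hb.sub_inf_le i j _ _) (BoolUltrafilter.mem_inf hx hy)
  mem_of_le h hx := BoolUltrafilter.mono (hb.sub_mono i j h) hx
  compl_mem_iff := by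
    intro x
    change sub c d i j xᶜ ∈ u ↔ sub c d i j x ∉ u
    have h1 : (sub c d i j x)ᶜ = sub c d i j xᶜ := by
      refine IsCompl.compl_eq (IsCompl.of_eq ?_ ?_)
      · rw [← le_bot_iff, ← hb.sub_bot i j, ← inf_compl_eq_bot (a := x)]
        exact hb.sub_inf_le i j _ _
      · rw [← hb.sub_sup, sup_compl_eq_top, sub_top hb hd]
    rw [← h1, BoolUltrafilter.mem_compl]

theorem mem_subUltrafilter {u : BoolUltrafilter A} :
    x ∈ subUltrafilter hb hd i j u ↔ sub c d i j x ∈ u := Iff.rfl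

end Algebra

open BoolUltrafilter

/-! ### The ultrafilter frame of an algebra -/

section UltrafilterFrame

variable {n : ℕ} {A : Type u} [BooleanAlgebra A] {c : Fin n → A → A} {d : Fin n → Fin n → A}

/-- Ultrafilters are related when one contains the `i`-th cylindrifications of the other. -/
def ufRel (c : Fin n → A → A) (i : Fin n) (u v : BoolUltrafilter A) : Prop := ∀ x ∈ v, c i x ∈ u

theorem ufRel_symm (hb : BasicAxioms c d) {i : Fin n} {u v : BoolUltrafilter A}
    (h : ufRel c i u v) : ufRel c i v u := by
  intro x hx
  by_contra hxv
  have h1 := h _ (mem_compl.2 hxv)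
  rw [hb.c_compl_c] at h1
  exact mem_compl.1 h1 (mono (hb.ax2 i x) hx)

theorem ufRel_comm (hb : BasicAxioms c d) (hd : DiagAxioms c d) {i j k : Fin n}
    {a b e : BoolUltrafilter A} (hki : k ≠ i) (hkj : k ≠ j) (hE : d j k ∈ a) (hab : ufRel c j a b)
    (hbe : ufRel c i b e) : ∃ b', ufRel c i a b' ∧ ufRel c j b' e := by
  obtain ⟨u, hu⟩ := exists_of_directed (S := {z | ∃ x ∈ a, ∃ y ∈ e, z = c i x ⊓ c j y})
    ⟨_, ⊤, mem_top, ⊤, mem_top, rfl⟩ (by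
      rintro _ ⟨x, hx, y, hy, rfl⟩ _ ⟨x', hx', y', hy', rfl⟩
      refine ⟨_, ⟨x ⊓ x', mem_inf hx hx', y ⊓ y', mem_inf hy hy', rfl⟩, ?_⟩
      exact le_inf (inf_le_inf (hb.c_mono i inf_le_left) (hb.c_mono j inf_le_left))
        (inf_le_inf (hb.c_mono i inf_le_right) (hb.c_mono j inf_le_right))) (by
      rintro ⟨x, hx, y, hy, hxy⟩
      have h1 : c i (c j y) ∈ a :=
        -- (Ax8) exchanges the cylindrifications on the diagonal `d j k`, so `c i x ⊓ c j y` cannot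
        -- vanish.
        mono (hd.ax8 i j k hki hkj y) (mem_inf (hab _ (hbe _ hy)) hE)
      have h2 := mem_inf (mono (hb.ax2 i x) hx) h1
      rw [inf_comm, ← hb.ax3, inf_comm, ← hxy, hb.ax1] at h2
      exact not_mem_bot h2)
  refine ⟨u, ufRel_symm hb fun x hx => ?_, fun y hy => ?_⟩
  · exact mono inf_le_left (hu _ ⟨x, hx, ⊤, mem_top, rfl⟩)
  · exact mono inf_le_right (hu _ ⟨⊤, mem_top, y, hy, rfl⟩)

theorem d_trans (hb : BasicAxioms c d) (i j k : Fin n) : d i j ⊓ d j k ≤ d i k := by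
  by_cases hij : j = i
  · subst hij; exact inf_le_right
  by_cases hjk : j = k
  · subst hjk; exact inf_le_left
  · exact (hb.ax5 i k j hij hjk).1

theorem subUltrafilter_self (hb : BasicAxioms c d) (hd : DiagAxioms c d) (i : Fin n)
    (a : BoolUltrafilter A) : subUltrafilter hb hd i i a = a := by
  refine eq_of_subset fun x hx => ?_
  rw [mem_subUltrafilter] at hx
  simpa [sub] using hx

/-- The frame of all ultrafilters. -/
def ufFrame (hb : BasicAxioms c d) (hd : DiagAxioms c d) : Frame n (BoolUltrafilter A) where
  rel := ufRel c
  E i j u := d i j ∈ u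
  e := subUltrafilter hb hd
  rel_equiv i := ⟨fun u x hx => mono (hb.ax2 i x) hx, ufRel_symm hb, fun h h' x hx => by
    rw [← hb.c_c]; exact h _ (h' x hx)⟩
  E_refl i a := by rw [hb.ax4]; exact mem_top
  E_symm h := by rwa [d_comm hb hd]
  E_trans h h' := mono (d_trans hb _ _ _) (mem_inf h h')
  E_rel {i j k a b} hi hj h hE := by
    have h1 := ufRel_symm hb h _ hE
    rwa [d_comm hb hd, ← (hb.ax5 i j k hi hj).2.2, d_comm hb hd] at h1
  E_uniq {i j a b} hij h ha hb' := by
    refine (eq_of_subset fun x hx => ?_).symm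
    exact mono (hb.ax6 i j hij x) (mem_inf (h _ (mem_inf hx hb')) ha)
  e_self i a := subUltrafilter_self hb hd i a
  e_rel i j a := by
    intro x hx
    rw [mem_subUltrafilter] at hx
    refine mono ?_ hx
    unfold sub
    split_ifs
    · exact hb.ax2 i x
    · exact hb.c_mono i inf_le_left
  e_E i j a := by
    rw [mem_subUltrafilter]
    unfold sub
    split_ifs with hij
    · subst hij; rw [hb.ax4]; exact mem_top
    · rw [inf_idem, c_d hb hd i j hij]; exact mem_top
  rel_comm := ufRel_comm hb hd
  mgr {i j k m} hki hkj hkm hmi hmj a := by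
    intro x hx
    simp only [mem_subUltrafilter] at hx ⊢
    rw [hd.ax10 i j k m hki hkj hkm hmi hmj]
    exact mono (hb.sub_mono _ _ (hb.sub_mono _ _ (hb.sub_mono _ _ (hb.sub_mono _ _
      (hb.ax2 k x))))) hx

theorem ufFrame_exists_of_ax12 (hb : BasicAxioms c d) (hd : DiagAxioms c d) (hn : 3 ≤ n)
    (h12 : Ax12 c d) (a : BoolUltrafilter A) {i j : Fin n} (hij : i ≠ j) :
    ∃ b, (ufFrame hb hd).Permuted a (Equiv.swap i j) b := by
  have hmono : ∀ x y : A, x ≤ y → ∀ Y : A → A,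
      Y = (fun x => sub c d i j (c j x) ⊓ sub c d j i (c i x) ⊓
      (Finset.univ.filter fun k => k ≠ i ∧ k ≠ j).inf
        fun k => sub c d k i (sub c d i j (sub c d j k (c k x)))) → Y x ≤ Y y := by
    rintro x y hxy Y rfl
    refine inf_le_inf (inf_le_inf (hb.sub_mono _ _ (hb.c_mono _ hxy))
      (hb.sub_mono _ _ (hb.c_mono _ hxy))) (Finset.inf_mono_fun fun k _ => ?_)
    exact hb.sub_mono _ _ (hb.sub_mono _ _ (hb.sub_mono _ _ (hb.c_mono _ hxy)))
  obtain ⟨Y, hY⟩ : ∃ Y : A → A, Y = fun x => sub c d i j (c j x) ⊓ sub c d j i (c i x) ⊓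
      (Finset.univ.filter fun k => k ≠ i ∧ k ≠ j).inf
        fun k => sub c d k i (sub c d i j (sub c d j k (c k x))) := ⟨_, rfl⟩
  -- The outer `c_i c_j` of (Ax12) serve only to show `Y x ≠ ⊥` for `x ∈ a`.
  obtain ⟨b, hb'⟩ := exists_of_directed (S := {z | ∃ x ∈ a, z = Y x}) ⟨_, ⊤, mem_top, rfl⟩ (by
      rintro _ ⟨x, hx, rfl⟩ _ ⟨y, hy, rfl⟩
      exact ⟨_, ⟨x ⊓ y, mem_inf hx hy, rfl⟩, le_inf (hmono _ _ inf_le_left Y hY)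
        (hmono _ _ inf_le_right Y hY)⟩) (by
      rintro ⟨x, hx, h⟩
      have h1 := mono (h12 i j x) hx
      have h2 : c i (c j (Y x)) ∈ a := by rw [hY]; exact h1
      rw [← h, hb.ax1, hb.ax1] at h2
      exact not_mem_bot h2)
  have key : ∀ x ∈ a, Y x ∈ b := fun x hx => hb' _ ⟨x, hx, rfl⟩
  simp only [hY] at key
  refine ⟨b, Frame.permuted_swap hij (ufRel_symm hb fun x hx => ?_) (ufRel_symm hb fun x hx => ?_)
    (fun k hki hkj => ufRel_symm hb fun x hx => ?_) (Or.inl hn)⟩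
  · change sub c d i j (c j x) ∈ b
    exact mono (inf_le_left.trans inf_le_left) (key x hx)
  · change sub c d j i (c i x) ∈ b
    exact mono (inf_le_left.trans inf_le_right) (key x hx)
  · change sub c d k i (sub c d i j (sub c d j k (c k x))) ∈ b
    refine mono (inf_le_right.trans ?_) (key x hx)
    exact Finset.inf_le (f := fun k => sub c d k i (sub c d i j (sub c d j k (c k x))))
      (by simp [hki, hkj])

theorem ufFrame_exists_of_ax11 (hb : BasicAxioms c d) (hd : DiagAxioms c d) (hn : n = 2)
    (h11 : Ax11 c d) (a : BoolUltrafilter A) {i j : Fin n} (hi : (i : ℕ) = 0) (hj : (j : ℕ) = 1) :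
    ∃ b, (ufFrame hb hd).Permuted a (Equiv.swap i j) b := by
  have hij : i ≠ j := by rintro rfl; omega
  have hcases : ∀ l : Fin n, l = i ∨ l = j := fun l => by
    have := l.2
    rcases Nat.lt_or_ge (l : ℕ) 1 with h | h
    · left; ext; omega
    · right; ext; omega
  -- On the diagonal both places carry the same value and `a` is its own transposed point. Off it,
  -- the factor `-d_01` of (Ax11) puts `b` off the diagonal too.
  by_cases hE : d i j ∈ a
  · have hE' : ∀ l m, (ufFrame hb hd).E l m a := by
      intro l m
      rcases hcases l with rfl | rfl <;> rcases hcases m with rfl | rfl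
      · exact (ufFrame hb hd).E_refl _ _
      · exact hE
      · exact (ufFrame hb hd).E_symm hE
      · exact (ufFrame hb hd).E_refl _ _
    refine ⟨a, Frame.permuted_swap hij ?_ ?_ ?_ (Or.inr fun l m => ?_)⟩
    · rw [(ufFrame hb hd).e_eq_self (hE' i j)]; exact (ufFrame hb hd).rel_refl _ _
    · rw [(ufFrame hb hd).e_eq_self (hE' j i)]; exact (ufFrame hb hd).rel_refl _ _
    · intro k hki hkj
      rcases hcases k with rfl | rfl
      · exact absurd rfl hki
      · exact absurd rfl hkj
    · exact ⟨fun _ => hE' _ _, fun _ => hE' _ _⟩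
  · have hEc := mem_compl.2 hE
    obtain ⟨b, hb'⟩ := exists_of_directed (S := {z | ∃ x ∈ a,
        z = (d i j)ᶜ ⊓ sub c d i j (c j x) ⊓ sub c d j i (c i x)}) ⟨_, ⊤, mem_top, rfl⟩ (by
        rintro _ ⟨x, hx, rfl⟩ _ ⟨y, hy, rfl⟩
        refine ⟨_, ⟨x ⊓ y, mem_inf hx hy, rfl⟩, le_inf ?_ ?_⟩
        · exact inf_le_inf (inf_le_inf_left _ (hb.sub_mono _ _ (hb.c_mono _ inf_le_left)))
            (hb.sub_mono _ _ (hb.c_mono _ inf_le_left))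
        · exact inf_le_inf (inf_le_inf_left _ (hb.sub_mono _ _ (hb.c_mono _ inf_le_right)))
            (hb.sub_mono _ _ (hb.c_mono _ inf_le_right))) (by
        rintro ⟨x, hx, h⟩
        have h1 := mono (h11 i j hi hj x) (mem_inf hx hEc)
        rw [← h, hb.ax1, hb.ax1] at h1
        exact not_mem_bot h1)
    have key : ∀ x ∈ a, _ ∈ b := fun x hx => hb' _ ⟨x, hx, rfl⟩
    have hEb : d i j ∉ b :=
      mem_compl.1 (mono (inf_le_left.trans inf_le_left) (key ⊤ mem_top))
    have hab : ∀ l m, l ≠ m → ¬ (ufFrame hb hd).E l m a ∧ ¬ (ufFrame hb hd).E l m b := by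
      intro l m hlm
      rcases hcases l with rfl | rfl <;> rcases hcases m with rfl | rfl
      · exact absurd rfl hlm
      · exact ⟨hE, hEb⟩
      · exact ⟨fun h => hE ((ufFrame hb hd).E_symm h), fun h => hEb ((ufFrame hb hd).E_symm h)⟩
      · exact absurd rfl hlm
    refine ⟨b, Frame.permuted_swap hij (ufRel_symm hb fun x hx => ?_)
      (ufRel_symm hb fun x hx => ?_) (fun k hki hkj => ?_) (Or.inr fun l m => ?_)⟩
    · change sub c d i j (c j x) ∈ b
      exact mono (inf_le_left.trans inf_le_right) (key x hx)
    · change sub c d j i (c i x) ∈ b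
      exact mono inf_le_right (key x hx)
    · rcases hcases k with rfl | rfl
      · exact absurd rfl hki
      · exact absurd rfl hkj
    · by_cases hlm : l = m
      · subst hlm
        exact ⟨fun _ => (ufFrame hb hd).E_refl _ _, fun _ => (ufFrame hb hd).E_refl _ _⟩
      · exact ⟨fun h => absurd h (hab _ _ hlm).2,
          fun h => absurd h (hab _ _ fun he => hlm ((Equiv.swap i j).injective he)).1⟩

theorem ufFrame_exists_permuted (hb : BasicAxioms c d) (hd : DiagAxioms c d)
    (hp : PermAxioms c d) (a : BoolUltrafilter A) (π : Equiv.Perm (Fin n)) :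
    ∃ b, (ufFrame hb hd).Permuted a π b := by
  refine Frame.exists_permuted (fun a i j hij => ?_) a π
  rcases Nat.lt_or_ge n 3 with hn | hn
  · have hi := i.2
    have hj := j.2
    have hij' : (i : ℕ) ≠ j := fun h => hij (Fin.ext h)
    have hn2 : n = 2 := by omega
    rcases Nat.eq_zero_or_pos (i : ℕ) with h | h
    · exact ufFrame_exists_of_ax11 hb hd hn2 (hp.1 hn2) a h (by omega)
    · rw [Equiv.swap_comm]
      exact ufFrame_exists_of_ax11 hb hd hn2 (hp.1 hn2) a (by omega) (by omega)
  · exact ufFrame_exists_of_ax12 hb hd hn (hp.2 hn) a hij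

end UltrafilterFrame

open FirstOrder FirstOrder.Language

/-! ### Equations -/

/-- Terms in three variables. -/
abbrev Tm (n : ℕ) : Type := (lang n).Term (Empty ⊕ Fin 3)

namespace Tm

variable {n : ℕ}

/-- The `i`-th variable. -/
def x (i : Fin 3) : Tm n := Term.var (Sum.inr i)

/-- The sum of two terms. -/
def add (s t : Tm n) : Tm n := Term.func (L := lang n) (Op.add : Op n 2) ![s, t]

/-- The product of two terms. -/
def mul (s t : Tm n) : Tm n := Term.func (L := lang n) (Op.mul : Op n 2) ![s, t]

/-- The complement of a term. -/
def neg (s : Tm n) : Tm n := Term.func (L := lang n) (Op.neg : Op n 1) ![s]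

/-- The term `0`. -/
def zero : Tm n := Term.func (L := lang n) (Op.zero : Op n 0) ![]

/-- The term `1`. -/
def one : Tm n := Term.func (L := lang n) (Op.one : Op n 0) ![]

/-- The cylindrification of a term. -/
def cy (i : Fin n) (s : Tm n) : Tm n := Term.func (L := lang n) (Op.cyl i : Op n 1) ![s]

/-- The term `d_ij`. -/
def di (i j : Fin n) : Tm n := Term.func (L := lang n) (Op.diag i j : Op n 0) ![]

/-- The term `s^i_j s`. -/
def su (i j : Fin n) (s : Tm n) : Tm n := if i = j then s else cy i (mul s (di i j))

/-- The product of a list of terms. -/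
def prod (l : List (Tm n)) : Tm n := l.foldr mul one

section Realize

variable {A : Type u} [(lang n).Structure A] {v : Empty ⊕ Fin 3 → A} (s t : Tm n)

theorem realize_x (i : Fin 3) : (x i : Tm n).realize v = v (Sum.inr i) := rfl

theorem realize_func_two (o : (lang n).Functions 2) :
    (Term.func (L := lang n) o ![s, t]).realize v =
      Structure.funMap (L := lang n) o ![s.realize v, t.realize v] := by
  rw [Term.realize_func]
  congr 1
  funext i
  fin_cases i <;> rfl

theorem realize_func_one (o : (lang n).Functions 1) :
    (Term.func (L := lang n) o ![s]).realize v = Structure.funMap (L := lang n) o ![s.realize v] := by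
  rw [Term.realize_func]
  congr 1
  funext i
  fin_cases i; rfl

theorem realize_func_zero (o : (lang n).Functions 0) :
    (Term.func (L := lang n) o ![] : Tm n).realize v = Structure.funMap (L := lang n) o ![] := by
  rw [Term.realize_func]
  congr 1
  funext i
  exact i.elim0

theorem realize_cy (i : Fin n) : (cy i s).realize v = cyl n A i (s.realize v) :=
  realize_func_one s _

theorem realize_di (i j : Fin n) : (di i j : Tm n).realize v = diag n A i j :=
  realize_func_zero _

theorem realize_add' : (add s t).realize v =
    Structure.funMap (L := lang n) (Op.add : Op n 2) ![s.realize v, t.realize v] :=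
  realize_func_two s t _

theorem realize_mul' : (mul s t).realize v =
    Structure.funMap (L := lang n) (Op.mul : Op n 2) ![s.realize v, t.realize v] :=
  realize_func_two s t _

theorem realize_neg' : (neg s).realize v =
    Structure.funMap (L := lang n) (Op.neg : Op n 1) ![s.realize v] :=
  realize_func_one s _

theorem realize_zero' : (zero : Tm n).realize v =
    Structure.funMap (L := lang n) (Op.zero : Op n 0) ![] :=
  realize_func_zero _

theorem realize_one' : (one : Tm n).realize v =
    Structure.funMap (L := lang n) (Op.one : Op n 0) ![] :=
  realize_func_zero _

end Realize

section RealizeBool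

variable {A : Type u} [(lang n).Structure A] [B : BooleanAlgebra A] (hA : HasReduct n A B)
  {v : Empty ⊕ Fin 3 → A} (s t : Tm n)
include hA

theorem realize_add : (add s t).realize v = s.realize v ⊔ t.realize v :=
  (realize_add' s t).trans (hA.add_eq _ _)

theorem realize_mul : (mul s t).realize v = s.realize v ⊓ t.realize v :=
  (realize_mul' s t).trans (hA.mul_eq _ _)

theorem realize_neg : (neg s).realize v = (s.realize v)ᶜ :=
  (realize_neg' s).trans (hA.neg_eq _)

theorem realize_zero : (zero : Tm n).realize v = ⊥ :=
  realize_zero'.trans hA.zero_eq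

theorem realize_one : (one : Tm n).realize v = ⊤ :=
  realize_one'.trans hA.one_eq

theorem realize_su (i j : Fin n) :
    (su i j s).realize v = sub (cyl n A) (diag n A) i j (s.realize v) := by
  unfold su sub
  split_ifs
  · rfl
  · rw [realize_cy, realize_mul hA, realize_di]

theorem realize_prod {ι : Type*} (S : Finset ι) (f : ι → Tm n) :
    (prod (S.toList.map f)).realize v = S.inf fun i => (f i).realize v := by
  have h : ∀ l : List ι,
      (prod (l.map f)).realize v = (l.map fun i => (f i).realize v).foldr (· ⊓ ·) ⊤ := by
    intro l
    induction l with
    | nil => exact realize_one hA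
    | cons i l ih =>
      rw [List.map_cons, prod, List.foldr_cons, realize_mul hA]
      exact congrArg _ ih
  rw [h, Finset.inf_def, Multiset.inf, ← Finset.coe_toList S, Multiset.map_coe, Multiset.coe_fold_r]

end RealizeBool

end Tm

/-- An equation, as a pair of terms. -/
abbrev Eqn (n : ℕ) : Type := Tm n × Tm n

/-- The equation that says `s ≤ t`. -/
def leEqn {n : ℕ} (s t : Tm n) : Eqn n := (Tm.mul s t, s)

/-- The universal closure of an equation. -/
def Eqn.sentence {n : ℕ} (p : Eqn n) : (lang n).Sentence :=
  BoundedFormula.alls (Term.bdEqual p.1 p.2)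

/-- The equation holds in the algebra `A`. -/
def Eqn.Holds {n : ℕ} (p : Eqn n) (A : Type u) [(lang n).Structure A] : Prop :=
  ∀ xs : Fin 3 → A, p.1.realize (Sum.elim Empty.elim xs) = p.2.realize (Sum.elim Empty.elim xs)

theorem Eqn.realize_sentence {n : ℕ} (p : Eqn n) (A : Type u) [(lang n).Structure A] :
    A ⊨ p.sentence ↔ p.Holds A := by
  rw [Eqn.sentence, Sentence.Realize, BoundedFormula.realize_alls]
  simp only [BoundedFormula.realize_bdEqual, Eqn.Holds]
  have : (default : Empty → A) = Empty.elim := funext fun e => e.elim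
  rw [this]

/-- The equational form of the axioms lets them descend from full set algebras to everything
embedded in them. -/
theorem Eqn.Holds.of_injective {n : ℕ} {p : Eqn n} {A M : Type u} [(lang n).Structure A]
    [(lang n).Structure M] (h : p.Holds M) (f : A →[lang n] M) (hf : Function.Injective f) :
    p.Holds A := by
  intro xs
  apply hf
  have h1 : (f ∘ Sum.elim Empty.elim xs : Empty ⊕ Fin 3 → M) = Sum.elim Empty.elim (f ∘ xs) := by
    funext e
    rcases e with e | e
    · exact e.elim
    · rfl
  have h2 := h (f ∘ xs)
  rwa [← h1, HomClass.realize_term, HomClass.realize_term] at h2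

open Tm

/-- The axioms of Boolean algebras. -/
def boolEqs (n : ℕ) : Set (Eqn n) :=
  {(add (x 0) (x 1), add (x 1) (x 0)), (mul (x 0) (x 1), mul (x 1) (x 0)),
    (add (add (x 0) (x 1)) (x 2), add (x 0) (add (x 1) (x 2))),
    (mul (mul (x 0) (x 1)) (x 2), mul (x 0) (mul (x 1) (x 2))),
    (add (x 0) (mul (x 0) (x 1)), x 0), (mul (x 0) (add (x 0) (x 1)), x 0),
    (mul (add (x 0) (x 1)) (add (x 0) (x 2)), add (x 0) (mul (x 1) (x 2))),
    (mul (x 0) (neg (x 0)), zero), (add (x 0) (neg (x 0)), one)}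

section

variable {n : ℕ} {A : Type u} [(lang n).Structure A]

/-- The Boolean algebra that the axioms provide. -/
@[reducible]
def booleanAlgebraOfOps {A : Type u} (p m : A → A → A) (ng : A → A) (z o : A)
    (p_comm : ∀ x y, p x y = p y x) (m_comm : ∀ x y, m x y = m y x)
    (p_assoc : ∀ x y z, p (p x y) z = p x (p y z)) (m_assoc : ∀ x y z, m (m x y) z = m x (m y z))
    (p_m : ∀ x y, p x (m x y) = x) (m_p : ∀ x y, m x (p x y) = x)
    (distrib : ∀ x y z, m (p x y) (p x z) = p x (m y z))
    (m_ng : ∀ x, m x (ng x) = z) (p_ng : ∀ x, p x (ng x) = o) : BooleanAlgebra A :=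
  letI : Max A := ⟨p⟩
  letI : Min A := ⟨m⟩
  letI L : Lattice A := Lattice.mk' p_comm p_assoc m_comm m_assoc p_m m_p
  { L with
    compl := ng
    top := o
    bot := z
    le_sup_inf := fun a b c => (distrib a b c).le
    inf_compl_le_bot := fun a => (m_ng a).le
    top_le_sup_compl := fun a => (p_ng a).ge
    le_top := fun a => by
      have : a ⊔ ng a = o := p_ng a
      rw [← this]; exact le_sup_left
    bot_le := fun a => by
      have : a ⊓ ng a = z := m_ng a
      rw [← this]; exact inf_le_left }

theorem forall_boolEqs_iff :
    (∀ p ∈ boolEqs n, p.Holds A) ↔ ∃ B : BooleanAlgebra A, HasReduct n A B := by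
  constructor
  · intro h
    simp only [boolEqs, Set.mem_insert_iff, Set.mem_singleton_iff, forall_eq_or_imp, forall_eq,
      Eqn.Holds, realize_add', realize_mul', realize_neg', realize_zero', realize_one', realize_x, Sum.elim_inr] at h
    obtain ⟨h1, h2, h3, h4, h5, h6, h7, h8, h9⟩ := h
    exact ⟨booleanAlgebraOfOps
      (fun a b => Structure.funMap (L := lang n) (Op.add : Op n 2) ![a, b])
      (fun a b => Structure.funMap (L := lang n) (Op.mul : Op n 2) ![a, b])
      (fun a => Structure.funMap (L := lang n) (Op.neg : Op n 1) ![a])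
      (Structure.funMap (L := lang n) (Op.zero : Op n 0) ![])
      (Structure.funMap (L := lang n) (Op.one : Op n 0) ![])
      (fun a b => h1 ![a, b, b]) (fun a b => h2 ![a, b, b]) (fun a b c => h3 ![a, b, c])
      (fun a b c => h4 ![a, b, c]) (fun a b => h5 ![a, b, b]) (fun a b => h6 ![a, b, b])
      (fun a b c => h7 ![a, b, c]) (fun a => h8 ![a, a, a]) (fun a => h9 ![a, a, a]),
      ⟨fun _ _ => rfl, fun _ _ => rfl, fun _ => rfl, rfl, rfl⟩⟩
  · rintro ⟨B, hA⟩
    simp only [boolEqs, Set.mem_insert_iff, Set.mem_singleton_iff, forall_eq_or_imp, forall_eq,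
      Eqn.Holds, realize_add hA, realize_mul hA, realize_neg hA, realize_zero hA, realize_one hA]
    exact ⟨fun _ => sup_comm _ _, fun _ => inf_comm _ _, fun _ => sup_assoc _ _ _,
      fun _ => inf_assoc _ _ _, fun _ => sup_inf_self, fun _ => inf_sup_self,
      fun _ => (sup_inf_left _ _ _).symm, fun _ => inf_compl_eq_bot, fun _ => sup_compl_eq_top⟩

end

/-! ### The axioms as finite sets of equations -/

/-- The equations (Ax1) to (Ax6). -/
def basicEqs (n : ℕ) : Set (Eqn n) :=
  (Set.range fun i => (cy i zero, zero)) ∪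
  (Set.range fun i => leEqn (x 0) (cy i (x 0))) ∪
  (Set.range fun i => (cy i (mul (x 0) (cy i (x 1))), mul (cy i (x 0)) (cy i (x 1)))) ∪
  (Set.range fun i => (di i i, one)) ∪
  (Set.range fun t : {t : Fin n × Fin n × Fin n // t.2.2 ≠ t.1 ∧ t.2.2 ≠ t.2.1} =>
    leEqn (mul (di t.1.1 t.1.2.2) (di t.1.2.2 t.1.2.1)) (di t.1.1 t.1.2.1)) ∪
  (Set.range fun t : {t : Fin n × Fin n × Fin n // t.2.2 ≠ t.1 ∧ t.2.2 ≠ t.2.1} =>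
    (di t.1.1 t.1.2.1, di t.1.2.1 t.1.1)) ∪
  (Set.range fun t : {t : Fin n × Fin n × Fin n // t.2.2 ≠ t.1 ∧ t.2.2 ≠ t.2.1} =>
    (di t.1.2.1 t.1.1, cy t.1.2.2 (di t.1.2.1 t.1.1))) ∪
  (Set.range fun t : {t : Fin n × Fin n // t.1 ≠ t.2} =>
    leEqn (mul (cy t.1.1 (mul (x 0) (di t.1.1 t.1.2))) (di t.1.1 t.1.2)) (x 0))

/-- The equations (Ax8) to (Ax10). -/
def diagEqs (n : ℕ) : Set (Eqn n) :=
  (Set.range fun t : {t : Fin n × Fin n × Fin n // t.2.2 ≠ t.1 ∧ t.2.2 ≠ t.2.1} =>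
    leEqn (mul (cy t.1.2.1 (cy t.1.1 (x 0))) (di t.1.2.1 t.1.2.2))
      (cy t.1.1 (cy t.1.2.1 (x 0)))) ∪
  (Set.range fun t : {t : Fin n × Fin n × Fin n // t.2.2 ≠ t.1 ∧ t.2.2 ≠ t.2.1} =>
    (di t.1.1 t.1.2.1, cy t.1.2.2 (mul (di t.1.1 t.1.2.2) (di t.1.2.2 t.1.2.1)))) ∪
  (Set.range fun t : {t : Fin n × Fin n × Fin n × Fin n // t.2.2.1 ≠ t.1 ∧ t.2.2.1 ≠ t.2.1 ∧
      t.2.2.1 ≠ t.2.2.2 ∧ t.2.2.2 ≠ t.1 ∧ t.2.2.2 ≠ t.2.1} =>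
    (su t.1.2.2.1 t.1.1 (su t.1.1 t.1.2.1 (su t.1.2.1 t.1.2.2.2 (su t.1.2.2.2 t.1.2.2.1
      (cy t.1.2.2.1 (x 0))))),
     su t.1.2.2.1 t.1.2.2.2 (su t.1.2.2.2 t.1.1 (su t.1.1 t.1.2.1 (su t.1.2.1 t.1.2.2.1
      (cy t.1.2.2.1 (x 0)))))))

/-- The equations (Ax11), if `n = 2`, and (Ax12), if `3 ≤ n`. -/
noncomputable def permEqs (n : ℕ) : Set (Eqn n) :=
  (Set.range fun t : {t : Fin n × Fin n // n = 2 ∧ (t.1 : ℕ) = 0 ∧ (t.2 : ℕ) = 1} =>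
    leEqn (mul (x 0) (neg (di t.1.1 t.1.2))) (cy t.1.1 (cy t.1.2 (mul (mul (neg (di t.1.1 t.1.2))
      (su t.1.1 t.1.2 (cy t.1.2 (x 0)))) (su t.1.2 t.1.1 (cy t.1.1 (x 0))))))) ∪
  (Set.range fun t : {_t : Fin n × Fin n // 3 ≤ n} =>
    leEqn (x 0) (cy t.1.1 (cy t.1.2 (mul (mul (su t.1.1 t.1.2 (cy t.1.2 (x 0)))
      (su t.1.2 t.1.1 (cy t.1.1 (x 0))))
      (prod ((Finset.univ.filter fun k => k ≠ t.1.1 ∧ k ≠ t.1.2).toList.map fun k =>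
        su k t.1.1 (su t.1.1 t.1.2 (su t.1.2 k (cy k (x 0))))))))))

theorem finite_boolEqs (n : ℕ) : (boolEqs n).Finite := by
  unfold boolEqs
  exact Set.toFinite _

theorem finite_basicEqs (n : ℕ) : (basicEqs n).Finite := by
  simp only [basicEqs, Set.finite_union]
  exact ⟨⟨⟨⟨⟨⟨⟨Set.finite_range _, Set.finite_range _⟩, Set.finite_range _⟩, Set.finite_range _⟩,
    Set.finite_range _⟩, Set.finite_range _⟩, Set.finite_range _⟩, Set.finite_range _⟩

theorem finite_diagEqs (n : ℕ) : (diagEqs n).Finite := by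
  simp only [diagEqs, Set.finite_union]
  exact ⟨⟨Set.finite_range _, Set.finite_range _⟩, Set.finite_range _⟩

theorem finite_permEqs (n : ℕ) : (permEqs n).Finite := by
  simp only [permEqs, Set.finite_union]
  exact ⟨Set.finite_range _, Set.finite_range _⟩

section

variable {n : ℕ} {A : Type u} [(lang n).Structure A] [B : BooleanAlgebra A] (hA : HasReduct n A B)
include hA

theorem forall_basicEqs_iff :
    (∀ p ∈ basicEqs n, p.Holds A) ↔ BasicAxioms (cyl n A) (diag n A) := by
  simp only [basicEqs, Set.mem_union, or_imp, forall_and, Set.forall_mem_range, Subtype.forall,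
    Prod.forall, Eqn.Holds, leEqn, realize_mul hA, realize_zero hA, realize_one hA, realize_cy,
    realize_di, realize_x, Sum.elim_inr, inf_eq_left]
  constructor
  · rintro ⟨⟨⟨⟨⟨⟨⟨h1, h2⟩, h3⟩, h4⟩, h5⟩, h5'⟩, h5''⟩, h6⟩
    exact ⟨fun i => h1 i fun _ => ⊥, fun i x => h2 i fun _ => x, fun i x y => h3 i ![x, y, y],
      fun i => h4 i fun _ => ⊥, fun i j k hi hj => ⟨h5 i j k ⟨hi, hj⟩ fun _ => ⊥,
        h5' i j k ⟨hi, hj⟩ fun _ => ⊥, h5'' i j k ⟨hi, hj⟩ fun _ => ⊥⟩,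
      fun i j hij x => h6 i j hij fun _ => x⟩
  · intro h
    exact ⟨⟨⟨⟨⟨⟨⟨fun i _ => h.ax1 i, fun i _ => h.ax2 i _⟩, fun i _ => h.ax3 i _ _⟩,
      fun i _ => h.ax4 i⟩, fun i j k hk _ => (h.ax5 i j k hk.1 hk.2).1⟩,
      fun i j k hk _ => (h.ax5 i j k hk.1 hk.2).2.1⟩,
      fun i j k hk _ => (h.ax5 i j k hk.1 hk.2).2.2⟩, fun i j hij _ => h.ax6 i j hij _⟩

theorem forall_diagEqs_iff :
    (∀ p ∈ diagEqs n, p.Holds A) ↔ DiagAxioms (cyl n A) (diag n A) := by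
  simp only [diagEqs, Set.mem_union, or_imp, forall_and, Set.forall_mem_range, Subtype.forall,
    Prod.forall, Eqn.Holds, leEqn, realize_mul hA, realize_cy, realize_su hA,
    realize_di, realize_x, Sum.elim_inr, inf_eq_left]
  constructor
  · rintro ⟨⟨h8, h9⟩, h10⟩
    exact ⟨fun i j k hi hj x => h8 i j k ⟨hi, hj⟩ fun _ => x,
      fun i j k hi hj => h9 i j k ⟨hi, hj⟩ fun _ => ⊥,
      fun i j k m h1 h2 h3 h4 h5 x => h10 i j k m ⟨h1, h2, h3, h4, h5⟩ fun _ => x⟩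
  · intro h
    exact ⟨⟨fun i j k hk _ => h.ax8 i j k hk.1 hk.2 _, fun i j k hk _ => h.ax9 i j k hk.1 hk.2⟩,
      fun i j k m h' _ => h.ax10 i j k m h'.1 h'.2.1 h'.2.2.1 h'.2.2.2.1 h'.2.2.2.2 _⟩

theorem forall_permEqs_iff :
    (∀ p ∈ permEqs n, p.Holds A) ↔ PermAxioms (cyl n A) (diag n A) := by
  simp only [permEqs, Set.mem_union, or_imp, forall_and, Set.forall_mem_range, Subtype.forall,
    Prod.forall, Eqn.Holds, leEqn, realize_mul hA, realize_cy, realize_su hA, realize_neg hA,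
    realize_di, realize_x, Sum.elim_inr, inf_eq_left, realize_prod hA]
  constructor
  · rintro ⟨h11, h12⟩
    exact ⟨fun hn i j hi hj x => h11 i j ⟨hn, hi, hj⟩ fun _ => x,
      fun hn i j x => h12 i j hn fun _ => x⟩
  · rintro ⟨h11, h12⟩
    exact ⟨fun i j h _ => h11 h.1 i j h.2.1 h.2.2 _, fun i j hn _ => h12 hn i j _⟩

end

/-- The equations of `DC_n⁻`. -/
def dcEqs (n : ℕ) : Set (Eqn n) := boolEqs n ∪ (basicEqs n ∪ diagEqs n)

/-- The equations of `SC_n⁻`. -/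
noncomputable def scEqs (n : ℕ) : Set (Eqn n) := dcEqs n ∪ permEqs n

theorem finite_dcEqs (n : ℕ) : (dcEqs n).Finite :=
  (finite_boolEqs n).union ((finite_basicEqs n).union (finite_diagEqs n))

theorem finite_scEqs (n : ℕ) : (scEqs n).Finite := (finite_dcEqs n).union (finite_permEqs n)

theorem isDCMinus_iff (n : ℕ) (A : Type u) [(lang n).Structure A] :
    IsDCMinus n A ↔ ∀ p ∈ dcEqs n, p.Holds A := by
  simp only [dcEqs, Set.mem_union, or_imp, forall_and]
  rw [forall_boolEqs_iff]
  constructor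
  · rintro ⟨B, hA, hb, hd⟩
    exact ⟨⟨B, hA⟩, (forall_basicEqs_iff hA).2 hb, (forall_diagEqs_iff hA).2 hd⟩
  · rintro ⟨⟨B, hA⟩, hb, hd⟩
    exact ⟨B, hA, (forall_basicEqs_iff hA).1 hb, (forall_diagEqs_iff hA).1 hd⟩

theorem isSCMinus_iff (n : ℕ) (A : Type u) [(lang n).Structure A] :
    IsSCMinus n A ↔ ∀ p ∈ scEqs n, p.Holds A := by
  simp only [scEqs, dcEqs, Set.mem_union, or_imp, forall_and]
  rw [forall_boolEqs_iff]
  constructor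
  · rintro ⟨B, hA, hb, hd, hp⟩
    exact ⟨⟨⟨B, hA⟩, (forall_basicEqs_iff hA).2 hb, (forall_diagEqs_iff hA).2 hd⟩,
      (forall_permEqs_iff hA).2 hp⟩
  · rintro ⟨⟨⟨B, hA⟩, hb, hd⟩, hp⟩
    exact ⟨B, hA, (forall_basicEqs_iff hA).1 hb, (forall_diagEqs_iff hA).1 hd,
      (forall_permEqs_iff hA).1 hp⟩

/-- The sentence `0 ≠ 1`. -/
def nontrivialSentence (n : ℕ) : (lang n).Sentence := ∼ (Eqn.sentence (zero, one))

theorem realize_nontrivialSentence {n : ℕ} {A : Type u} [(lang n).Structure A]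
    {B : BooleanAlgebra A} (hA : HasReduct n A B) : A ⊨ nontrivialSentence n ↔ Nontrivial A := by
  rw [nontrivialSentence, Sentence.Realize, Formula.realize_not]
  change ¬ (A ⊨ Eqn.sentence (zero, one)) ↔ _
  rw [Eqn.realize_sentence]
  simp only [Eqn.Holds, realize_zero hA, realize_one hA, forall_const]
  constructor
  · intro h; exact ⟨⊥, ⊤, h⟩
  · intro h; exact bot_ne_top

theorem finitelyAxiomatizable_of_eqs {n : ℕ} {S : Set (Eqn n)} (hS : S.Finite)
    (hbool : boolEqs n ⊆ S) {C : ∀ (A : Type u) [(lang n).Structure A], Prop}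
    (hC : ∀ (A : Type u) [(lang n).Structure A], C A ↔ (∀ p ∈ S, p.Holds A) ∧ Nontrivial A) :
    FinitelyAxiomatizable n C := by
  refine ⟨insert (nontrivialSentence n) (Eqn.sentence '' S), (hS.image _).insert _, fun A _ => ?_⟩
  rw [hC, Theory.model_iff]
  simp only [Set.mem_insert_iff, Set.mem_image, forall_eq_or_imp, forall_exists_index, and_imp,
    forall_apply_eq_imp_iff₂, Eqn.realize_sentence]
  rw [and_comm]
  refine and_congr_right fun h => ?_
  obtain ⟨B, hA⟩ := forall_boolEqs_iff.1 fun p hp => h p (hbool hp)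
  exact realize_nontrivialSentence hA

/-! ### Set algebras satisfy the axioms -/

section SetAlgebra

variable {n : ℕ} {U : Type u} {V : Set (Fin n → U)}

instance FullAlg.instBooleanAlgebra (V : Set (Fin n → U)) : BooleanAlgebra (FullAlg V) :=
  inferInstanceAs (BooleanAlgebra (Set V))

instance FullAlg.instMembership (V : Set (Fin n → U)) : Membership V (FullAlg V) :=
  inferInstanceAs (Membership V (Set V))

theorem FullAlg.hasReduct (V : Set (Fin n → U)) : HasReduct n (FullAlg V) inferInstance :=
  ⟨fun _ _ => rfl, fun _ _ => rfl, fun _ => rfl, rfl, rfl⟩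

namespace FullAlg

variable {X Y : FullAlg V} {f : V} {i j : Fin n}

theorem ext' (h : ∀ f, f ∈ X ↔ f ∈ Y) : X = Y := Set.ext h

theorem mem_inf : f ∈ X ⊓ Y ↔ f ∈ X ∧ f ∈ Y := Iff.rfl

theorem not_mem_bot : ¬ f ∈ (⊥ : FullAlg V) := fun h => h

theorem mem_top : f ∈ (⊤ : FullAlg V) := trivial

theorem mem_cyl : f ∈ cyl n (FullAlg V) i X ↔ ∃ g ∈ X, ∀ l, l ≠ i → g.1 l = f.1 l := Iff.rfl

theorem mem_finset_inf {ι : Type*} {S : Finset ι} {F : ι → FullAlg V} :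
    f ∈ S.inf F ↔ ∀ k ∈ S, f ∈ F k := by
  induction S using Finset.cons_induction with
  | empty => simp [mem_top]
  | cons k S hk ih => simp [Finset.inf_cons, mem_inf, ih]

theorem mem_sub (hV : Diagonalizable V) : f ∈ sub (cyl n (FullAlg V)) (diag n (FullAlg V)) i j X ↔
    (⟨f.1 ∘ repl i j, hV f.1 f.2 i j⟩ : V) ∈ X := by
  unfold sub
  split_ifs with hij
  · subst hij
    simp only [repl_same, Function.comp_id]
  rw [mem_cyl]
  constructor
  · rintro ⟨g, ⟨hg, hd⟩, hgf⟩
    have hd' : g.1 i = g.1 j := hd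
    have : (⟨f.1 ∘ repl i j, hV f.1 f.2 i j⟩ : V) = g := by
      ext l
      change f.1 (repl i j l) = g.1 l
      by_cases hl : l = i
      · subst hl
        rw [repl_self, hd', hgf j (Ne.symm hij)]
      · rw [repl_of_ne hl, hgf l hl]
    rwa [this]
  · intro h
    refine ⟨_, ⟨h, ?_⟩, fun l hl => ?_⟩
    · change f.1 (repl i j i) = f.1 (repl i j j)
      rw [repl_self, repl_of_ne (Ne.symm hij)]
    · change f.1 (repl i j l) = f.1 l
      rw [repl_of_ne hl]

theorem basicAxioms (V : Set (Fin n → U)) :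
    BasicAxioms (cyl n (FullAlg V)) (diag n (FullAlg V)) where
  ax1 i := le_bot_iff.1 fun f ⟨g, hg, _⟩ => hg
  ax2 i X := fun f hf => ⟨f, hf, fun _ _ => rfl⟩
  ax3 i X Y := by
    apply ext'
    intro f
    constructor
    · rintro ⟨g, ⟨hg, g', hg', hgg'⟩, hgf⟩
      exact ⟨⟨g, hg, hgf⟩, g', hg', fun l hl => (hgg' l hl).trans (hgf l hl)⟩
    · rintro ⟨⟨g, hg, hgf⟩, g', hg', hgf'⟩
      exact ⟨g, ⟨hg, g', hg', fun l hl => (hgf' l hl).trans (hgf l hl).symm⟩, hgf⟩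
  ax4 i := top_le_iff.1 fun f _ => (rfl : f.1 i = f.1 i)
  ax5 i j k hi hj := by
    refine ⟨fun f ⟨h, h'⟩ => ?_, ext' fun f => ⟨fun h => ?_, fun h => ?_⟩, ext' fun f => ⟨fun h => ?_, ?_⟩⟩
    · exact Eq.trans (b := f.1 k) h h'
    · exact Eq.symm (a := f.1 i) h
    · exact Eq.symm (a := f.1 j) h
    · exact ⟨f, h, fun _ _ => rfl⟩
    · rintro ⟨g, hg, hgf⟩
      change f.1 j = f.1 i
      rw [← hgf i (Ne.symm hi), ← hgf j (Ne.symm hj)]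
      exact hg
  ax6 i j hij X := by
    rintro f ⟨⟨g, ⟨hg, hd⟩, hgf⟩, hd'⟩
    have : g = f := by
      ext l
      by_cases hl : l = i
      · subst hl
        exact (Eq.trans (b := g.1 j) hd (hgf j (Ne.symm hij))).trans (Eq.symm (a := f.1 l) hd')
      · exact hgf l hl
    exact this ▸ hg

theorem diagAxioms (hV : Diagonalizable V) :
    DiagAxioms (cyl n (FullAlg V)) (diag n (FullAlg V)) where
  ax8 i j k hi hj X := by
    rintro f ⟨⟨g, ⟨h, hh, hhg⟩, hgf⟩, hd⟩
    have hd' : f.1 j = f.1 k := hd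
    by_cases hij : i = j
    · subst hij
      exact ⟨g, ⟨h, hh, hhg⟩, hgf⟩
    -- Resetting place `j` of `h` to its value at `k`, which is `f j`, leaves a sequence that
    -- differs from `f` at `i` only.
    refine ⟨⟨h.1 ∘ repl j k, hV _ h.2 j k⟩, ⟨h, hh, fun l hl => ?_⟩, fun l hl => ?_⟩
    · change h.1 l = h.1 (repl j k l)
      rw [repl_of_ne hl]
    · change h.1 (repl j k l) = f.1 l
      by_cases hlj : l = j
      · subst hlj
        rw [repl_self, hhg k hi, hgf k hj, hd']
      · rw [repl_of_ne hlj, hhg l hl, hgf l hlj]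
  ax9 i j k hi hj := by
    apply ext'
    intro f
    constructor
    · intro h
      have h' : f.1 i = f.1 j := h
      refine ⟨⟨f.1 ∘ repl k i, hV _ f.2 k i⟩, ⟨?_, ?_⟩, fun l hl => ?_⟩
      · change f.1 (repl k i i) = f.1 (repl k i k)
        rw [repl_self, repl_of_ne (Ne.symm hi)]
      · change f.1 (repl k i k) = f.1 (repl k i j)
        rw [repl_self, repl_of_ne (Ne.symm hj), h']
      · change f.1 (repl k i l) = f.1 l
        rw [repl_of_ne hl]
    · rintro ⟨g, ⟨h, h'⟩, hgf⟩
      change f.1 i = f.1 j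
      rw [← hgf i (Ne.symm hi), ← hgf j (Ne.symm hj)]
      exact Eq.trans (b := g.1 k) h h'
  ax10 i j k m hki hkj hkm hmi hmj X := by
    apply ext'
    intro f
    simp only [mem_sub hV, mem_cyl]
    refine exists_congr fun g => and_congr_right fun _ => forall_congr' fun l =>
      imp_congr_right fun hl => ?_
    -- The transformations on the two sides agree at every place other than `k`.
    refine Eq.congr_right ?_
    simp only [Function.comp_apply, repl, Function.update_apply, id]
    grind

/-- The intermediate sequence `f ∘ [i/j]` differs from `f` at most at `i` and from `f ∘ [i,j]` at
most at `j`. -/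
theorem mem_cyl_cyl_of_swap (hV : Diagonalizable V) (hP : Permutable V)
    (h : (⟨f.1 ∘ Equiv.swap i j, hP f.1 f.2 i j⟩ : V) ∈ X) :
    f ∈ cyl n (FullAlg V) i (cyl n (FullAlg V) j X) := by
  refine ⟨⟨f.1 ∘ repl i j, hV _ f.2 i j⟩, ⟨_, h, fun l hl => ?_⟩, fun l hl => ?_⟩
  · change f.1 (Equiv.swap i j l) = f.1 (repl i j l)
    rw [Equiv.swap_apply_def]
    simp only [repl, Function.update_apply, id, hl, if_false]
  · change f.1 (repl i j l) = f.1 l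
    rw [repl_of_ne hl]

theorem permAxioms (hV : Diagonalizable V) (hP : Permutable V) :
    PermAxioms (cyl n (FullAlg V)) (diag n (FullAlg V)) := by
  have h1 : ∀ (i j : Fin n) (X : FullAlg V) (f : V), f ∈ X →
      (⟨f.1 ∘ Equiv.swap i j, hP f.1 f.2 i j⟩ : V) ∈
        sub (cyl n (FullAlg V)) (diag n (FullAlg V)) i j (cyl n (FullAlg V) j X) := by
    intro i j X f hf
    rw [mem_sub hV]
    refine ⟨f, hf, fun l hl => ?_⟩
    change f.1 l = f.1 (Equiv.swap i j (repl i j l))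
    simp only [Equiv.swap_apply_def, repl, Function.update_apply, id]
    grind
  have h2 : ∀ (i j : Fin n) (X : FullAlg V) (f : V), f ∈ X →
      (⟨f.1 ∘ Equiv.swap i j, hP f.1 f.2 i j⟩ : V) ∈
        sub (cyl n (FullAlg V)) (diag n (FullAlg V)) j i (cyl n (FullAlg V) i X) := by
    intro i j X f hf
    have := h1 j i X f hf
    simpa only [Equiv.swap_comm i j] using this
  refine ⟨fun _ i j _ _ X => ?_, fun _ i j X => ?_⟩
  · rintro f ⟨hf, hd⟩
    refine mem_cyl_cyl_of_swap hV hP ⟨⟨fun h => hd ?_, h1 i j X f hf⟩, h2 i j X f hf⟩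
    have h' : f.1 (Equiv.swap i j i) = f.1 (Equiv.swap i j j) := h
    rw [Equiv.swap_apply_left, Equiv.swap_apply_right] at h'
    exact h'.symm
  · intro f hf
    refine mem_cyl_cyl_of_swap hV hP ⟨⟨h1 i j X f hf, h2 i j X f hf⟩, mem_finset_inf.2 fun k hk => ?_⟩
    simp only [Finset.mem_filter, Finset.mem_univ, true_and] at hk
    rw [mem_sub hV, mem_sub hV, mem_sub hV]
    refine ⟨f, hf, fun l hl => ?_⟩
    change f.1 l = f.1 (Equiv.swap i j (repl k i (repl i j (repl j k l))))
    simp only [Equiv.swap_apply_def, repl, Function.update_apply, id]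
    grind

/-- Each cylindrification changes only place `K t`, which carries none of the values tracked from
`S`. -/
theorem mem_subChain (hV : Diagonalizable V) (I J K : ℕ → Fin n) (S : Set (Fin n)) {f : V} {m : ℕ}
    (hf : f ∈ subChain (cyl n (FullAlg V)) (diag n (FullAlg V)) I J K X m)
    (hS : ∀ t < m, K t ∉ replChain I J t '' S) :
    ∃ g ∈ X, ∀ l ∈ S, g.1 l = f.1 (replChain I J m l) := by
  induction m generalizing f with
  | zero => exact ⟨f, hf, fun _ _ => rfl⟩
  | succ m ih =>
    rw [subChain, mem_sub hV] at hf
    obtain ⟨f', hf', hff'⟩ := hf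
    obtain ⟨g, hg, hgf⟩ := ih hf' fun t ht => hS t (ht.trans (Nat.lt_succ_self m))
    refine ⟨g, hg, fun l hl => (hgf l hl).trans ?_⟩
    exact hff' _ fun h => hS m (Nat.lt_succ_self m) ⟨l, hl, h⟩

theorem replChain_of_ne {I J : ℕ → Fin n} {l : Fin n} {m : ℕ} (h : ∀ t < m, l ≠ I t) :
    replChain I J m l = l := by
  induction m with
  | zero => rfl
  | succ m ih =>
    rw [replChain, Function.comp_apply, ih fun t ht => h t (ht.trans (Nat.lt_succ_self m)),
      repl_of_ne (h m (Nat.lt_succ_self m))]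

theorem ax7 (hV : Diagonalizable V) : Ax7 (cyl n (FullAlg V)) (diag n (FullAlg V)) := by
  rintro m - I J K i S hS hK X f ⟨hf, hd⟩
  have hS' : ∀ l, l ∈ S ↔ l ≠ i ∧ ((∃ t < m, I t = l) ∨ ∃ t < m, K t = l) := by
    intro l
    simp [hS]
  -- All places other than `i` can be tracked, not just those in `S`: the remaining ones occur among
  -- neither the `I t` nor the `K t`, so they are never moved or cylindrified.
  obtain ⟨g, hg, hgf⟩ := mem_subChain hV I J K {l | l ≠ i} hf (by
    rintro t ht ⟨l, hl, hlt⟩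
    by_cases hlS : l ∈ S
    · exact hK t ht (Finset.mem_image.2 ⟨l, hlS, hlt⟩)
    · have h1 : ∀ s < m, l ≠ I s := fun s hs h =>
        hlS ((hS' l).2 ⟨hl, Or.inl ⟨s, hs, h.symm⟩⟩)
      rw [replChain_of_ne fun s hs => h1 s (hs.trans ht)] at hlt
      exact hlS ((hS' l).2 ⟨hl, Or.inr ⟨t, ht, hlt.symm⟩⟩))
  refine ⟨g, hg, fun l hl => (hgf l hl).trans ?_⟩
  by_cases hlS : l ∈ S
  · exact (Eq.symm (a := f.1 l) (mem_finset_inf.1 hd l hlS))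
  · rw [replChain_of_ne fun s hs h => hlS ((hS' l).2 ⟨hl, Or.inl ⟨s, hs, h.symm⟩⟩)]

end FullAlg

end SetAlgebra

/-! ### Homomorphisms into set algebras -/

theorem hom_cyl {n : ℕ} {A M : Type u} [(lang n).Structure A] [(lang n).Structure M]
    (f : A →[lang n] M) (i : Fin n) (x : A) : f (cyl n A i x) = cyl n M i (f x) := by
  refine (f.map_fun (Op.cyl i : Op n 1) ![x]).trans ?_
  congr 1
  funext l
  fin_cases l; rfl

theorem hom_diag {n : ℕ} {A M : Type u} [(lang n).Structure A] [(lang n).Structure M]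
    (f : A →[lang n] M) (i j : Fin n) : f (diag n A i j) = diag n M i j := by
  refine (f.map_fun (Op.diag i j : Op n 0) ![]).trans ?_
  congr 1
  funext l
  exact l.elim0

section

variable {n : ℕ} {A M : Type u} [(lang n).Structure A] [(lang n).Structure M]
  [BA : BooleanAlgebra A] [BM : BooleanAlgebra M] (hA : HasReduct n A BA) (hM : HasReduct n M BM)
  (f : A →[lang n] M)
include hA hM

theorem hom_inf (x y : A) : f (x ⊓ y) = f x ⊓ f y := by
  rw [← hA.mul_eq, ← hM.mul_eq]
  refine (f.map_fun (Op.mul : Op n 2) ![x, y]).trans ?_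
  congr 1
  funext l
  fin_cases l <;> rfl

theorem hom_top : f ⊤ = ⊤ := by
  rw [← hA.one_eq, ← hM.one_eq]
  refine (f.map_fun (Op.one : Op n 0) ![]).trans ?_
  congr 1
  funext l
  exact l.elim0

theorem hom_bot : f ⊥ = ⊥ := by
  rw [← hA.zero_eq, ← hM.zero_eq]
  refine (f.map_fun (Op.zero : Op n 0) ![]).trans ?_
  congr 1
  funext l
  exact l.elim0

theorem Ax7.of_injective (h : Ax7 (cyl n M) (diag n M)) (hf : Function.Injective f) :
    Ax7 (cyl n A) (diag n A) := by
  intro m hm I J K i S hS hK x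
  have hsub : ∀ i j x, f (sub (cyl n A) (diag n A) i j x) = sub (cyl n M) (diag n M) i j (f x) := by
    intro i j x
    unfold sub
    split_ifs
    · rfl
    · rw [hom_cyl, hom_inf hA hM, hom_diag]
  have hchain : ∀ m, f (subChain (cyl n A) (diag n A) I J K x m) =
      subChain (cyl n M) (diag n M) I J K (f x) m := by
    intro m
    induction m with
    | zero => rfl
    | succ m ih => rw [subChain, hsub, hom_cyl, ih, subChain]
  have hinf : ∀ (S : Finset (Fin n)) (g : Fin n → A), f (S.inf g) = S.inf fun l => f (g l) := by
    intro S g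
    induction S using Finset.cons_induction with
    | empty => exact hom_top hA hM f
    | cons k S hk ih => rw [Finset.inf_cons, Finset.inf_cons, hom_inf hA hM, ih]
  have h1 := h m hm I J K i S hS hK (f x)
  rw [← inf_eq_left] at h1 ⊢
  apply hf
  rw [hom_inf hA hM, hom_inf hA hM, hchain, hinf, hom_cyl]
  simpa only [hom_diag] using h1

end

theorem Ax7.of_subsingleton {n : ℕ} {A : Type u} [BooleanAlgebra A] [Subsingleton A]
    (c : Fin n → A → A) (d : Fin n → Fin n → A) : Ax7 c d :=
  fun _ _ _ _ _ _ _ _ _ _ => (Subsingleton.elim _ _).le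

section

variable {n : ℕ} {A : Type u} [(lang n).Structure A]

theorem exists_hom_of_equiv {U : Type u} {V : Set (Fin n → U)}
    {B : (lang n).Substructure (FullAlg V)} (e : A ≃[lang n] B) :
    ∃ f : A →[lang n] FullAlg V, Function.Injective f :=
  ⟨B.subtype.toHom.comp e.toHom, fun _ _ h => e.injective (Subtype.ext h)⟩

theorem nontrivial_of_hom {U : Type u} {V : Set (Fin n → U)} (hV : V.Nonempty)
    {BA : BooleanAlgebra A} (hA : HasReduct n A BA) (f : A →[lang n] FullAlg V) : Nontrivial A := by
  refine ⟨⊥, ⊤, fun h => ?_⟩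
  have h1 := congrArg f h
  rw [hom_bot hA (FullAlg.hasReduct V), hom_top hA (FullAlg.hasReduct V)] at h1
  obtain ⟨g, hg⟩ := hV
  have h2 : (⟨g, hg⟩ : V) ∈ (⊤ : FullAlg V) := FullAlg.mem_top
  rw [← h1] at h2
  exact FullAlg.not_mem_bot h2

theorem IsRepDC.isDCMinus (h : IsRepDC n A) : IsDCMinus n A ∧ Nontrivial A := by
  obtain ⟨U, V, hne, hV, B, ⟨e⟩⟩ := h
  obtain ⟨f, hf⟩ := exists_hom_of_equiv e
  have h1 : IsDCMinus n A := (isDCMinus_iff n A).2 fun p hp =>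
    ((isDCMinus_iff n (FullAlg V)).1
      ⟨_, FullAlg.hasReduct V, FullAlg.basicAxioms V, FullAlg.diagAxioms hV⟩ p hp).of_injective f hf
  obtain ⟨BA, hA, -⟩ := id h1
  exact ⟨h1, nontrivial_of_hom hne hA f⟩

theorem IsRepSC.isSCMinus (h : IsRepSC n A) : IsSCMinus n A ∧ Nontrivial A := by
  obtain ⟨U, V, hne, hV, hP, B, ⟨e⟩⟩ := h
  obtain ⟨f, hf⟩ := exists_hom_of_equiv e
  have h1 : IsSCMinus n A := (isSCMinus_iff n A).2 fun p hp =>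
    ((isSCMinus_iff n (FullAlg V)).1 ⟨_, FullAlg.hasReduct V, FullAlg.basicAxioms V,
      FullAlg.diagAxioms hV, FullAlg.permAxioms hV hP⟩ p hp).of_injective f hf
  obtain ⟨BA, hA, -⟩ := id h1
  exact ⟨h1, nontrivial_of_hom hne hA f⟩

theorem IsRepDC.ax7 (h : IsRepDC n A) [BA : BooleanAlgebra A] (hA : HasReduct n A BA) :
    Ax7 (cyl n A) (diag n A) := by
  obtain ⟨U, V, -, hV, B, ⟨e⟩⟩ := h
  obtain ⟨f, hf⟩ := exists_hom_of_equiv e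
  exact Ax7.of_injective hA (FullAlg.hasReduct V) f (FullAlg.ax7 hV) hf

end

/-! ### Representing algebras by representations of their ultrafilter frames -/

open BoolUltrafilter in
theorem exists_ufRel {n : ℕ} {A : Type u} [BooleanAlgebra A] {c : Fin n → A → A}
    {d : Fin n → Fin n → A} (hb : BasicAxioms c d) {i : Fin n} {u : BoolUltrafilter A} {x : A}
    (hx : c i x ∈ u) : ∃ v, x ∈ v ∧ ufRel c i u v := by
  obtain ⟨v, hv⟩ := exists_of_directed (S := {z | ∃ y ∈ u, z = x ⊓ c i y}) ⟨_, ⊤, mem_top, rfl⟩ (by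
    rintro _ ⟨y, hy, rfl⟩ _ ⟨y', hy', rfl⟩
    exact ⟨_, ⟨y ⊓ y', mem_inf hy hy', rfl⟩, le_inf
      (inf_le_inf_left _ (hb.c_mono i inf_le_left)) (inf_le_inf_left _ (hb.c_mono i inf_le_right))⟩)
    (by
      rintro ⟨y, hy, h⟩
      have h1 := mem_inf hx (mono (hb.ax2 i y) hy)
      rw [← hb.ax3, ← h, hb.ax1] at h1
      exact not_mem_bot h1)
  exact ⟨v, mono inf_le_left (hv _ ⟨⊤, mem_top, rfl⟩), ufRel_symm hb fun y hy =>
    mono inf_le_right (hv _ ⟨y, hy, rfl⟩)⟩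

namespace BoolUltrafilter

variable {A : Type u} [BooleanAlgebra A] {x y : A}

theorem mem_inf_iff {u : BoolUltrafilter A} : x ⊓ y ∈ u ↔ x ∈ u ∧ y ∈ u :=
  ⟨fun h => ⟨mono inf_le_left h, mono inf_le_right h⟩, fun h => mem_inf h.1 h.2⟩

theorem mem_sup_iff {u : BoolUltrafilter A} : x ⊔ y ∈ u ↔ x ∈ u ∨ y ∈ u := by
  rw [← compl_compl (x ⊔ y), mem_compl, compl_sup, mem_inf_iff, mem_compl, mem_compl]
  tauto

theorem le_of_forall (h : ∀ u : BoolUltrafilter A, x ∈ u → y ∈ u) : x ≤ y := by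
  by_contra hxy
  rw [← disjoint_compl_right_iff, disjoint_iff] at hxy
  obtain ⟨u, hu⟩ := exists_mem hxy
  rw [mem_inf_iff, mem_compl] at hu
  exact hu.2 (h u hu.1)

end BoolUltrafilter

section

variable {n : ℕ} {A : Type u} [(lang n).Structure A] [BA : BooleanAlgebra A]
  {hb : BasicAxioms (cyl n A) (diag n A)} {hd : DiagAxioms (cyl n A) (diag n A)}
  {P : Submonoid (Equiv.Perm (Fin n))}

/-- The elements of `A` as sets of sequences, given a representation of the ultrafilter frame. -/
def reprMap (R : (ufFrame hb hd).Representation P) (x : A) : FullAlg R.V :=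
  ({f | x ∈ R.lab f} : Set R.V)

theorem mem_reprMap {R : (ufFrame hb hd).Representation P} {x : A} {f : R.V} :
    f ∈ reprMap R x ↔ x ∈ R.lab f := Iff.rfl

theorem reprMap_injective (R : (ufFrame hb hd).Representation P) :
    Function.Injective (reprMap R) := by
  intro x y h
  have key : ∀ u : BoolUltrafilter A, x ∈ u ↔ y ∈ u := by
    intro u
    obtain ⟨f, rfl⟩ := R.surj u
    rw [← mem_reprMap, ← mem_reprMap, h]
  exact le_antisymm (BoolUltrafilter.le_of_forall fun u => (key u).1)
    (BoolUltrafilter.le_of_forall fun u => (key u).2)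

/-- One inclusion is the back property, applied to an ultrafilter witnessing `c_i x`; the other is
that `lab` preserves `rel`. -/
theorem reprMap_cyl (R : (ufFrame hb hd).Representation P) (i : Fin n) (x : A) :
    reprMap R (cyl n A i x) = cyl n (FullAlg R.V) i (reprMap R x) := by
  apply FullAlg.ext'
  intro f
  rw [mem_reprMap, FullAlg.mem_cyl]
  constructor
  · intro h
    obtain ⟨v, hxv, hv⟩ := exists_ufRel hb h
    obtain ⟨g, rfl, hg⟩ := R.back f i v hv
    exact ⟨g, hxv, hg⟩
  · rintro ⟨g, hg, hgf⟩
    exact ufRel_symm hb (R.rel f g i hgf) x hg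

theorem reprMap_diag (R : (ufFrame hb hd).Representation P) (i j : Fin n) :
    reprMap R (diag n A i j) = diag n (FullAlg R.V) i j :=
  FullAlg.ext' fun f => (R.eq_iff f i j).symm

/-- The embedding of an algebra given by a representation of its ultrafilter frame. -/
def reprEmbedding (hA : HasReduct n A BA) (R : (ufFrame hb hd).Representation P) :
    A ↪[lang n] FullAlg R.V where
  toFun := reprMap R
  inj' := reprMap_injective R
  map_fun' := by
    intro k o x
    have h2 : ∀ y : Fin 2 → A, y = ![y 0, y 1] := fun y => by ext l; fin_cases l <;> rfl
    have h1 : ∀ y : Fin 1 → A, y = ![y 0] := fun y => by ext l; fin_cases l; rfl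
    have h0 : ∀ y : Fin 0 → A, y = ![] := fun y => by ext l; exact l.elim0
    match k, o with
    | _, Op.add =>
      rw [h2 x]
      refine (congrArg (reprMap R) (hA.add_eq _ _)).trans (FullAlg.ext' fun f => ?_)
      exact BoolUltrafilter.mem_sup_iff
    | _, Op.mul =>
      rw [h2 x]
      refine (congrArg (reprMap R) (hA.mul_eq _ _)).trans (FullAlg.ext' fun f => ?_)
      exact BoolUltrafilter.mem_inf_iff
    | _, Op.neg =>
      rw [h1 x]
      refine (congrArg (reprMap R) (hA.neg_eq _)).trans (FullAlg.ext' fun f => ?_)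
      exact BoolUltrafilter.mem_compl
    | _, Op.zero =>
      rw [h0 x]
      refine (congrArg (reprMap R) hA.zero_eq).trans (FullAlg.ext' fun f => ?_)
      exact iff_of_false BoolUltrafilter.not_mem_bot FullAlg.not_mem_bot
    | _, Op.one =>
      rw [h0 x]
      refine (congrArg (reprMap R) hA.one_eq).trans (FullAlg.ext' fun f => ?_)
      exact iff_of_true BoolUltrafilter.mem_top FullAlg.mem_top
    | _, Op.cyl i =>
      rw [h1 x]
      exact reprMap_cyl R i (x 0)
    | _, Op.diag i j =>
      rw [h0 x]
      exact reprMap_diag R i j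
  map_rel' := fun r => nomatch r

theorem exists_substructure (hA : HasReduct n A BA) (R : (ufFrame hb hd).Representation P) :
    ∃ B : (lang n).Substructure (FullAlg R.V), Nonempty (A ≃[lang n] B) :=
  ⟨_, ⟨(reprEmbedding hA R).equivRange⟩⟩

theorem nonempty_of_nontrivial [Nontrivial A] (R : (ufFrame hb hd).Representation P) :
    R.V.Nonempty := by
  obtain ⟨u, -⟩ := BoolUltrafilter.exists_mem (top_ne_bot (α := A))
  obtain ⟨f, -⟩ := R.surj u
  exact ⟨f.1, f.2⟩

end

/-! ### Representability and the redundancy of (Ax7) -/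

section

variable {n : ℕ} {A : Type u} [(lang n).Structure A]

theorem IsDCMinus.isRepDC (hn : 2 ≤ n) (h : IsDCMinus n A) [Nontrivial A] : IsRepDC n A := by
  have : Nontrivial (Fin n) := Fin.nontrivial_iff_two_le.2 hn
  obtain ⟨B, hA, hb, hd⟩ := h
  let R := (Frame.PermChoice.trivial (ufFrame hb hd)).representation
  exact ⟨R.U, R.V, nonempty_of_nontrivial R, R.diagonalizable, exists_substructure hA R⟩

theorem IsSCMinus.isRepSC (hn : 2 ≤ n) (h : IsSCMinus n A) [Nontrivial A] : IsRepSC n A := by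
  have : Nontrivial (Fin n) := Fin.nontrivial_iff_two_le.2 hn
  obtain ⟨B, hA, hb, hd, hp⟩ := h
  obtain ⟨C, hC⟩ := Frame.PermChoice.exists_top (ufFrame_exists_permuted hb hd hp)
  let R := C.representation
  exact ⟨R.U, R.V, nonempty_of_nontrivial R, R.diagonalizable,
    fun f hf i j => R.comp_mem f hf _ (hC ▸ Submonoid.mem_top _), exists_substructure hA R⟩

theorem isDCMinus_and_nontrivial_iff (hn : 2 ≤ n) :
    (IsDCMinus n A ∧ Nontrivial A) ↔ IsRepDC n A :=
  ⟨fun ⟨h, _⟩ => h.isRepDC hn, IsRepDC.isDCMinus⟩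

theorem isSCMinus_and_nontrivial_iff (hn : 2 ≤ n) :
    (IsSCMinus n A ∧ Nontrivial A) ↔ IsRepSC n A :=
  ⟨fun ⟨h, _⟩ => h.isRepSC hn, IsRepSC.isSCMinus⟩

theorem ax7_of_axioms (hn : 2 ≤ n) [B : BooleanAlgebra A] (hA : HasReduct n A B)
    (hb : BasicAxioms (cyl n A) (diag n A)) (hd : DiagAxioms (cyl n A) (diag n A)) :
    Ax7 (cyl n A) (diag n A) := by
  rcases subsingleton_or_nontrivial A with _ | _
  · exact Ax7.of_subsingleton _ _
  · exact IsRepDC.ax7 (IsDCMinus.isRepDC hn ⟨B, hA, hb, hd⟩) hA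

theorem isDCMinus_iff_isDC (hn : 2 ≤ n) : IsDCMinus n A ↔ IsDC n A :=
  ⟨fun ⟨B, hA, hb, hd⟩ => ⟨B, hA, hb, ax7_of_axioms hn hA hb hd, hd⟩,
    fun ⟨B, hA, hb, _, hd⟩ => ⟨B, hA, hb, hd⟩⟩

theorem isSCMinus_iff_isSC (hn : 2 ≤ n) : IsSCMinus n A ↔ IsSC n A :=
  ⟨fun ⟨B, hA, hb, hd, hp⟩ => ⟨B, hA, hb, ax7_of_axioms hn hA hb hd, hd, hp⟩,
    fun ⟨B, hA, hb, _, hd, hp⟩ => ⟨B, hA, hb, hd, hp⟩⟩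

end

end CylAlg

theorem mainTheorem3 (n : ℕ) (hn : 2 ≤ n) :
    (∀ (A : Type u) [(CylAlg.lang n).Structure A],
      ((CylAlg.IsDCMinus n A ∧ Nontrivial A) ↔ CylAlg.IsRepDC n A) ∧
      ((CylAlg.IsSCMinus n A ∧ Nontrivial A) ↔ CylAlg.IsRepSC n A) ∧
      (CylAlg.IsDCMinus n A ↔ CylAlg.IsDC n A) ∧
      (CylAlg.IsSCMinus n A ↔ CylAlg.IsSC n A)) ∧
    CylAlg.FinitelyAxiomatizable.{u} n (fun A _ => CylAlg.IsRepDC n A) ∧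
    CylAlg.FinitelyAxiomatizable.{u} n (fun A _ => CylAlg.IsRepSC n A) := by
  refine ⟨fun A _ => ⟨CylAlg.isDCMinus_and_nontrivial_iff hn,
    CylAlg.isSCMinus_and_nontrivial_iff hn, CylAlg.isDCMinus_iff_isDC hn,
    CylAlg.isSCMinus_iff_isSC hn⟩, ?_, ?_⟩
  · refine CylAlg.finitelyAxiomatizable_of_eqs (CylAlg.finite_dcEqs n) Set.subset_union_left
      fun A _ => ?_
    rw [← CylAlg.isDCMinus_and_nontrivial_iff hn, CylAlg.isDCMinus_iff]
  · refine CylAlg.finitelyAxiomatizable_of_eqs (CylAlg.finite_scEqs n)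
      (Set.subset_union_left.trans Set.subset_union_left) fun A _ => ?_
    rw [← CylAlg.isSCMinus_and_nontrivial_iff hn, CylAlg.isSCMinus_iff]
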